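/- Let $\gamma\in\mathbb R$, and let $u=(u^1,u^2)$ be real field variables depending on $(t,x)$, with $u^1\neq0$. Consider the system \[ u^1_t=u^2_x,\qquad u^2_t=\left(\frac{(u^2)^2+\gamma}{u^1}\right)_x . \] Conventions. A differential function is a smooth function of $x$ and of finitely many $x$-derivatives $u^i_k=D_x^ku^i$ ($k\ge 0$) on the domain $u^1\ne0$; $D_x$ is the total $x$-derivative. A matrix differential operator $A^{ij}=\sum_k a^{ij}_kD_x^k$ with differential functions as coefficients is Hamiltonian if it is formally skew-adjoint and $[A,A]=0$. Here the Schouten bracket of two operators is \[ [A,B](\psi^1,\psi^2,\psi^3)=\big(\ell_{A,\psi^1}(B\psi^2)\big)^i\psi^3_i+\big(\ell_{B,\psi^1}(A\psi^2)\big)^i\psi^3_i+\text{cyclic}(\psi^1,\psi^2,\psi^3) \quad\text{modulo the image of } D_x, \] for all covectors $\psi^a=(\psi^a_i)$ of differential functions, with $\ell_{A,\psi}(\varphi)^i=\sum\frac{\partial a^{ij}_k}{\partial u^s_l}\,D_x^k\psi_j\,D_x^l\varphi^s$. Two Hamiltonian operators $A,B$ are compatible if $A+\lambda B$ is Hamiltonian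 for every $\lambda\in\mathbb R$. A system $u^i_t=F^i$ is Hamiltonian with respect to $A$ if $F^i=A^{ij}\,\delta H/\delta u^j$ for some functional $H=\int h(u)\,dx$ with $h$ smooth. A local first-order homogeneous (Dubrovin--Novikov) operator parameterised by a contravariant metric $g=(g^{ij}(u))$ is $P^{ij}=g^{ij}D_x+\Gamma^{ij}_ku^k_x$, where the functions $\Gamma^{ij}_k(u)$ are smooth for $u^1\neq0$ and $\Gamma^{ij}_k=-g^{is}\Gamma^j_{sk}$ wherever $\det g\ne0$, with $\Gamma^j_{sk}$ the Christoffel symbols of the Levi-Civita connection of $(g_{ij})=(g^{ij})^{-1}$. Theorem. The three metrics \[ g^{(2,1)}=\begin{pmatrix}-u^1&0\\0&\frac{(u^2)^2+\gamma}{u^1}\end{pmatrix},\qquad g^{(2,2)}=\begin{pmatrix}0&u^1\\u^1&2u^2\end{pmatrix},\qquad g^{(2,3)}=\begin{pmatrix}2u^2&\frac{(u^2)^2+\gamma}{u^1}\\\frac{(u^2)^2+\gamma}{u^1}&0\end{pmatrix} \] parameterise Hamiltonian Dubrovin--Novikov operators $P^{(2,1)}$, $P^{(2,2)}$, $P^{(2,3)}$.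 The system is Hamiltonian with respect to each of them, they are mutually compatible, and each of them is compatible with the third-order Hamiltonian operator \[ R^{(2)}=D_x\begin{pmatrix}0&D_x\frac1{u^1}\\ \frac1{u^1}D_x&\frac{u^2}{(u^1)^2}D_x+D_x\frac{u^2}{(u^1)^2}\end{pmatrix}D_x . \] -/

import Mathlib

open scoped ContDiff

noncomputable section

namespace HamOp

/-! ### Smooth differential functions

The independent variable is `x`, the field variables are `u^0, …, u^(n-1)` with values in an open
set `Ω ⊆ ℝⁿ`, and `u^i_k` is the `k`-th `x`-derivative of `u^i`. -/

/-- The space of infinite jets: a point is `(x, u)`, where `u k i` is the jet coordinate `u^i_k`. -/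
abbrev Jet (n : ℕ) : Type := ℝ × (ℕ → Fin n → ℝ)

/-- The part of the jet space that lies over the open set `Ω` of values of the field variables. -/
abbrev JetOver {n : ℕ} (Ω : TopologicalSpace.Opens (Fin n → ℝ)) : Type :=
  {p : Jet n // p.2 0 ∈ Ω}

/-- Truncation of a jet at order `N`. -/
def trunc {n : ℕ} (N : ℕ) (p : Jet n) : ℝ × (Fin (N + 1) → Fin n → ℝ) :=
  (p.1, fun k => p.2 k)

/-- A function on the jets over `Ω` is a differential function if it is a smooth function of `x`
and of finitely many of the jet coordinates. -/
def IsDiffFun {n : ℕ} (Ω : TopologicalSpace.Opens (Fin n → ℝ)) (f : JetOver Ω → ℝ) : Prop :=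
  ∃ (N : ℕ) (F : ℝ × (Fin (N + 1) → Fin n → ℝ) → ℝ),
    ContDiffOn ℝ ∞ F {q | q.2 0 ∈ Ω} ∧ ∀ p : JetOver Ω, f p = F (trunc N p.1)

theorem IsDiffFun.raise {n : ℕ} {Ω : TopologicalSpace.Opens (Fin n → ℝ)} {N M : ℕ} (h : N ≤ M)
    {f : JetOver Ω → ℝ} {F : ℝ × (Fin (N + 1) → Fin n → ℝ) → ℝ}
    (hF : ContDiffOn ℝ ∞ F {q | q.2 0 ∈ Ω}) (hf : ∀ p : JetOver Ω, f p = F (trunc N p.1)) :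
    ∃ G : ℝ × (Fin (M + 1) → Fin n → ℝ) → ℝ,
      ContDiffOn ℝ ∞ G {q | q.2 0 ∈ Ω} ∧ ∀ p : JetOver Ω, f p = G (trunc M p.1) := by
  refine ⟨fun q => F (q.1, fun k => q.2 (Fin.castLE (by omega) k)), ?_, ?_⟩
  · refine hF.comp (t := {q | q.2 0 ∈ Ω}) ?_ ?_
    · exact ContDiff.contDiffOn (by fun_prop)
    · intro q hq
      exact hq
  · intro p
    rw [hf p]
    rfl

theorem IsDiffFun.op₂ {n : ℕ} {Ω : TopologicalSpace.Opens (Fin n → ℝ)} {f g : JetOver Ω → ℝ}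
    (hf : IsDiffFun Ω f) (hg : IsDiffFun Ω g) (m : ℝ × ℝ → ℝ) (hm : ContDiff ℝ ∞ m) :
    IsDiffFun Ω (fun p => m (f p, g p)) := by
  obtain ⟨N, F, hF, hf⟩ := hf
  obtain ⟨M, G, hG, hg⟩ := hg
  obtain ⟨F', hF', hf'⟩ := IsDiffFun.raise (le_max_left N M) hF hf
  obtain ⟨G', hG', hg'⟩ := IsDiffFun.raise (le_max_right N M) hG hg
  exact ⟨max N M, fun q => m (F' q, G' q), hm.comp_contDiffOn (hF'.prodMk hG'),
    fun p => by simp only [hf' p, hg' p]⟩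

/-- The algebra of differential functions over `Ω`. -/
def diffFunAlgebra {n : ℕ} (Ω : TopologicalSpace.Opens (Fin n → ℝ)) :
    Subalgebra ℝ (JetOver Ω → ℝ) where
  carrier := {f | IsDiffFun Ω f}
  mul_mem' := fun hf hg => IsDiffFun.op₂ hf hg (fun z => z.1 * z.2) (by fun_prop)
  add_mem' := fun hf hg => IsDiffFun.op₂ hf hg (fun z => z.1 + z.2) (by fun_prop)
  algebraMap_mem' := fun r => ⟨0, fun _ => r, contDiffOn_const, fun _ => rfl⟩

/-- Differential functions over `Ω`. -/
abbrev DiffFun {n : ℕ} (Ω : TopologicalSpace.Opens (Fin n → ℝ)) : Type := diffFunAlgebra Ω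

/-- The derivative of a function on the jets over `Ω` along a constant vector `v`. -/
def dirDeriv {n : ℕ} {Ω : TopologicalSpace.Opens (Fin n → ℝ)} (v : Jet n) (f : JetOver Ω → ℝ) :
    JetOver Ω → ℝ :=
  fun p => deriv (fun s : ℝ => Function.extend Subtype.val f 0 (p.1 + s • v)) 0

theorem isOpen_jetsOver {n : ℕ} (Ω : TopologicalSpace.Opens (Fin n → ℝ)) (N : ℕ) :
    IsOpen {q : ℝ × (Fin (N + 1) → Fin n → ℝ) | q.2 0 ∈ Ω} :=
  Ω.isOpen.preimage (by fun_prop : Continuous fun q : ℝ × (Fin (N + 1) → Fin n → ℝ) => q.2 0)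

theorem dirDeriv_eq {n : ℕ} {Ω : TopologicalSpace.Opens (Fin n → ℝ)} {N : ℕ} {f : JetOver Ω → ℝ}
    {F : ℝ × (Fin (N + 1) → Fin n → ℝ) → ℝ}
    (hF : ContDiffOn ℝ ∞ F {q | q.2 0 ∈ Ω}) (hf : ∀ p : JetOver Ω, f p = F (trunc N p.1))
    (v : Jet n) (p : JetOver Ω) :
    dirDeriv v f p = fderiv ℝ F (trunc N p.1) (trunc N v) := by
  have hopen := isOpen_jetsOver Ω N
  have hmem : trunc N p.1 ∈ {q : ℝ × (Fin (N + 1) → Fin n → ℝ) | q.2 0 ∈ Ω} := p.2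
  have hd : DifferentiableAt ℝ F (trunc N p.1) :=
    (hF.contDiffAt (hopen.mem_nhds hmem)).differentiableAt (by simp)
  have hcurve : HasDerivAt (fun s : ℝ => trunc N p.1 + s • trunc N v) (trunc N v) 0 := by
    simpa using ((hasDerivAt_id (0 : ℝ)).smul_const (trunc N v)).const_add (trunc N p.1)
  have hcomp : HasDerivAt (fun s : ℝ => F (trunc N p.1 + s • trunc N v))
      (fderiv ℝ F (trunc N p.1) (trunc N v)) 0 := by
    refine HasFDerivAt.comp_hasDerivAt (0 : ℝ) ?_ hcurve
    simpa using hd.hasFDerivAt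
  have hev : (fun s : ℝ => Function.extend Subtype.val f 0 (p.1 + s • v)) =ᶠ[nhds 0]
      (fun s : ℝ => F (trunc N p.1 + s • trunc N v)) := by
    have hc : ContinuousAt (fun s : ℝ => trunc N p.1 + s • trunc N v) 0 := hcurve.continuousAt
    have h0 : {q : ℝ × (Fin (N + 1) → Fin n → ℝ) | q.2 0 ∈ Ω} ∈
        nhds (trunc N p.1 + (0 : ℝ) • trunc N v) := by
      simpa using hopen.mem_nhds hmem
    filter_upwards [hc h0] with s hs
    have hs' : (p.1 + s • v).2 0 ∈ Ω := hs
    have := Subtype.val_injective.extend_apply f 0 (⟨p.1 + s • v, hs'⟩ : JetOver Ω)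
    rw [this, hf]
    rfl
  exact (hcomp.congr_of_eventuallyEq hev).deriv

theorem isDiffFun_dirDeriv {n : ℕ} {Ω : TopologicalSpace.Opens (Fin n → ℝ)} (v : Jet n)
    {f : JetOver Ω → ℝ} (hf : IsDiffFun Ω f) : IsDiffFun Ω (dirDeriv v f) := by
  obtain ⟨N, F, hF, hf⟩ := hf
  refine ⟨N, fun q => fderiv ℝ F q (trunc N v), ?_, fun p => dirDeriv_eq hF hf v p⟩
  exact (hF.fderiv_of_isOpen (isOpen_jetsOver Ω N) (by simp)).clm_apply contDiffOn_const

/-- The partial derivative `∂/∂x` of differential functions. -/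
def pdX {n : ℕ} {Ω : TopologicalSpace.Opens (Fin n → ℝ)} (f : DiffFun Ω) : DiffFun Ω :=
  ⟨dirDeriv (1, 0) f.1, isDiffFun_dirDeriv _ f.2⟩

/-- The partial derivative `∂/∂u^i_k` of differential functions. -/
def pd {n : ℕ} {Ω : TopologicalSpace.Opens (Fin n → ℝ)} (i : Fin n) (k : ℕ) (f : DiffFun Ω) :
    DiffFun Ω :=
  ⟨dirDeriv (0, Pi.single k (Pi.single i 1)) f.1, isDiffFun_dirDeriv _ f.2⟩

/-- A differential function depends on finitely many jet coordinates only, so that the sums over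
all orders `k` below are finite sums. -/
theorem exists_order {n : ℕ} {Ω : TopologicalSpace.Opens (Fin n → ℝ)} (f : DiffFun Ω) :
    ∃ N : ℕ, ∀ (i : Fin n) (k : ℕ), N < k → pd i k f = 0 := by
  obtain ⟨N, F, hF, hf⟩ := f.2
  refine ⟨N, fun i k hk => Subtype.ext (funext fun p => ?_)⟩
  have hv : trunc N ((0, Pi.single k (Pi.single i 1)) : Jet n) = 0 := by
    refine Prod.ext rfl (funext fun l => ?_)
    have : (l : ℕ) ≠ k := by have := l.2; omega
    simp [trunc, this]
  change dirDeriv _ f.1 p = 0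
  rw [dirDeriv_eq hF hf, hv, map_zero]

/-- A smooth function of the field variables, as a differential function. -/
def ofBase {n : ℕ} {Ω : TopologicalSpace.Opens (Fin n → ℝ)} (h : (Fin n → ℝ) → ℝ)
    (hh : ContDiffOn ℝ ∞ h Ω) : DiffFun Ω :=
  ⟨fun p => h (p.1.2 0), 0, fun q => h (q.2 0),
    hh.comp (ContDiff.contDiffOn (by fun_prop)) (fun _ hq => hq), fun _ => rfl⟩

/-- The jet coordinate `u^i_k`. -/
def jetCoord {n : ℕ} (Ω : TopologicalSpace.Opens (Fin n → ℝ)) (i : Fin n) (k : ℕ) : DiffFun Ω :=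
  ⟨fun p => p.1.2 k i, k, fun q => q.2 (Fin.last k) i, ContDiff.contDiffOn (by fun_prop),
    fun _ => rfl⟩

/-- The total derivative `D_x = ∂/∂x + ∑ u^i_(k+1) ∂/∂u^i_k`. -/
def Dx {n : ℕ} {Ω : TopologicalSpace.Opens (Fin n → ℝ)} (f : DiffFun Ω) : DiffFun Ω :=
  pdX f + ∑ i : Fin n, ∑ᶠ k : ℕ, jetCoord Ω i (k + 1) * pd i k f

/-- The variational derivative `δh/δu^i = ∑ (-D_x)^k (∂h/∂u^i_k)` of the functional `∫ h dx`. -/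
def varDeriv {n : ℕ} {Ω : TopologicalSpace.Opens (Fin n → ℝ)} (h : DiffFun Ω) (i : Fin n) :
    DiffFun Ω :=
  ∑ᶠ k : ℕ, (-1) ^ k * Dx^[k] (pd i k h)

/-! ### Matrix differential operators -/

/-- Scalar differential operators `∑ a_k D_x^k`, given by their coefficients `a_k`. -/
abbrev DiffOp {n : ℕ} (Ω : TopologicalSpace.Opens (Fin n → ℝ)) : Type := ℕ →₀ DiffFun Ω

/-- Matrix differential operators `A^{ij} = ∑ a^{ij}_k D_x^k`. -/
abbrev MatDiffOp {n : ℕ} (Ω : TopologicalSpace.Opens (Fin n → ℝ)) : Type :=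
  Fin n → Fin n → DiffOp Ω

/-- The operator `D_x`. -/
def opD {n : ℕ} (Ω : TopologicalSpace.Opens (Fin n → ℝ)) : DiffOp Ω := Finsupp.single 1 1

/-- The operator of multiplication by a differential function. -/
def opMul {n : ℕ} {Ω : TopologicalSpace.Opens (Fin n → ℝ)} (f : DiffFun Ω) : DiffOp Ω :=
  Finsupp.single 0 f

/-- Composition of scalar operators, by the rule
`(c D_x^k) ∘ (d D_x^m) = ∑_{j ≤ k} (k choose j) c D_x^j(d) D_x^(k-j+m)`. -/
def opComp {n : ℕ} {Ω : TopologicalSpace.Opens (Fin n → ℝ)} (a b : DiffOp Ω) : DiffOp Ω :=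
  a.sum fun k c => b.sum fun m d => ∑ j ∈ Finset.range (k + 1),
    Finsupp.single (k - j + m) ((k.choose j : DiffFun Ω) * c * Dx^[j] d)

/-- `A(ψ)^i = ∑ a^{ij}_k D_x^k ψ_j`. -/
def MatDiffOp.app {n : ℕ} {Ω : TopologicalSpace.Opens (Fin n → ℝ)} (A : MatDiffOp Ω)
    (ψ : Fin n → DiffFun Ω) (i : Fin n) : DiffFun Ω :=
  ∑ j : Fin n, (A i j).sum fun k a => a * Dx^[k] (ψ j)

/-- The formal adjoint: `A^*(ψ)^i = ∑ (-D_x)^k (a^{ji}_k ψ_j)`. -/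
def MatDiffOp.adjApp {n : ℕ} {Ω : TopologicalSpace.Opens (Fin n → ℝ)} (A : MatDiffOp Ω)
    (ψ : Fin n → DiffFun Ω) (i : Fin n) : DiffFun Ω :=
  ∑ j : Fin n, (A j i).sum fun k a => (-1) ^ k * Dx^[k] (a * ψ j)

/-- The linearization `ℓ_{A,ψ}(φ)^i = ∑ (∂a^{ij}_k/∂u^s_l) D_x^k(ψ_j) D_x^l(φ^s)`. -/
def MatDiffOp.lin {n : ℕ} {Ω : TopologicalSpace.Opens (Fin n → ℝ)} (A : MatDiffOp Ω)
    (ψ φ : Fin n → DiffFun Ω) (i : Fin n) : DiffFun Ω :=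
  ∑ j : Fin n, (A i j).sum fun k a =>
    ∑ s : Fin n, ∑ᶠ l : ℕ, pd s l a * Dx^[k] (ψ j) * Dx^[l] (φ s)

/-- The pairing `φ^i ψ_i`. -/
def pair {n : ℕ} {Ω : TopologicalSpace.Opens (Fin n → ℝ)} (φ ψ : Fin n → DiffFun Ω) : DiffFun Ω :=
  ∑ i : Fin n, φ i * ψ i

/-- A representative of the Schouten bracket `[A, B](ψ₁, ψ₂, ψ₃)`, which is defined up to the image
of `D_x`. -/
def schouten {n : ℕ} {Ω : TopologicalSpace.Opens (Fin n → ℝ)} (A B : MatDiffOp Ω)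
    (ψ₁ ψ₂ ψ₃ : Fin n → DiffFun Ω) : DiffFun Ω :=
  (pair (A.lin ψ₁ (B.app ψ₂)) ψ₃ + pair (A.lin ψ₂ (B.app ψ₃)) ψ₁
      + pair (A.lin ψ₃ (B.app ψ₁)) ψ₂)
    + (pair (B.lin ψ₁ (A.app ψ₂)) ψ₃ + pair (B.lin ψ₂ (A.app ψ₃)) ψ₁
      + pair (B.lin ψ₃ (A.app ψ₁)) ψ₂)

/-- `[A, B] = 0`: the bracket is a total `x`-derivative for all covectors. -/
def SchoutenVanishes {n : ℕ} {Ω : TopologicalSpace.Opens (Fin n → ℝ)} (A B : MatDiffOp Ω) : Prop :=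
  ∀ ψ₁ ψ₂ ψ₃ : Fin n → DiffFun Ω, ∃ χ : DiffFun Ω, schouten A B ψ₁ ψ₂ ψ₃ = Dx χ

/-- `A` is a Hamiltonian operator: it is skew-adjoint and `[A, A] = 0`. -/
def IsHamiltonian {n : ℕ} {Ω : TopologicalSpace.Opens (Fin n → ℝ)} (A : MatDiffOp Ω) : Prop :=
  (∀ ψ : Fin n → DiffFun Ω, A.adjApp ψ = -A.app ψ) ∧ SchoutenVanishes A A

/-- Compatible Hamiltonian operators: `A + c B` is a Hamiltonian operator for every real `c`. -/
def Compatible {n : ℕ} {Ω : TopologicalSpace.Opens (Fin n → ℝ)} (A B : MatDiffOp Ω) : Prop :=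
  IsHamiltonian A ∧ IsHamiltonian B ∧ ∀ c : ℝ, IsHamiltonian (A + c • B)

/-- The evolutionary system `u^i_t = F^i` is Hamiltonian with respect to `A`, with a Hamiltonian
`∫ h(u) dx` of hydrodynamic type: `F = A(δh/δu)`. -/
def IsHamiltonianSystem {n : ℕ} {Ω : TopologicalSpace.Opens (Fin n → ℝ)} (A : MatDiffOp Ω)
    (F : Fin n → DiffFun Ω) : Prop :=
  ∃ (h : (Fin n → ℝ) → ℝ) (hh : ContDiffOn ℝ ∞ h Ω), F = A.app (varDeriv (ofBase h hh))

/-! ### First-order operators of Dubrovin–Novikov type -/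

/-- The partial derivative of a function of the field variables. -/
def partialU {n : ℕ} (k : Fin n) (f : (Fin n → ℝ) → ℝ) (u : Fin n → ℝ) : ℝ :=
  lineDeriv ℝ f u (Pi.single k 1)

/-- The Christoffel symbols `Γ^i_{jk}` of the Levi-Civita connection of the metric `(g_{ij})`
inverse to `(g^{ij})`. -/
def christoffel {n : ℕ} (g : (Fin n → ℝ) → Matrix (Fin n) (Fin n) ℝ) (i j k : Fin n)
    (u : Fin n → ℝ) : ℝ :=
  (1 / 2) * ∑ s : Fin n, g u i s *
    (partialU j (fun v => (g v)⁻¹ s k) u + partialU k (fun v => (g v)⁻¹ s j) u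
      - partialU s (fun v => (g v)⁻¹ j k) u)

/-- `P` is the local homogeneous first-order operator `P^{ij} = g^{ij} D_x + Γ^{ij}_k u^k_x` that is
parameterised by the contravariant metric `g`: the coefficients `Γ^{ij}_k` are smooth on `Ω`, and
`Γ^{ij}_k = -g^{is} Γ^j_{sk}` with the Levi-Civita Christoffel symbols wherever `det g ≠ 0`. -/
def IsDubrovinNovikov {n : ℕ} {Ω : TopologicalSpace.Opens (Fin n → ℝ)} (P : MatDiffOp Ω)
    (g : (Fin n → ℝ) → Matrix (Fin n) (Fin n) ℝ) : Prop :=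
  ∃ Γ : Fin n → Fin n → Fin n → (Fin n → ℝ) → ℝ,
    (∀ i j k, ContDiffOn ℝ ∞ (Γ i j k) Ω) ∧
    (∀ u ∈ Ω, (g u).det ≠ 0 → ∀ i j k, Γ i j k u = -∑ s : Fin n, g u i s * christoffel g j s k u) ∧
    ∀ i j : Fin n,
      (∀ p : JetOver Ω, (P i j 1).1 p = g (p.1.2 0) i j) ∧
      (∀ p : JetOver Ω, (P i j 0).1 p = ∑ k : Fin n, Γ i j k (p.1.2 0) * p.1.2 1 k) ∧
      ∀ m, 2 ≤ m → P i j m = 0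

/-! ### The two-component system

The field variables `u^1`, `u^2` have the indices `0`, `1`. -/

/-- The domain `u^1 ≠ 0`. -/
def dom : TopologicalSpace.Opens (Fin 2 → ℝ) :=
  ⟨{u | u 0 ≠ 0}, isOpen_ne_fun (continuous_apply 0) continuous_const⟩

/-- The function `1/u^1`. -/
def invU1 : DiffFun dom :=
  ofBase (fun u => (u 0)⁻¹)
    (ContDiffOn.inv (ContDiff.contDiffOn (by fun_prop)) (fun _ hu => hu))

/-- The function `u^2`. -/
def u2 : DiffFun dom := jetCoord dom 1 0

/-- The right-hand sides of `u^1_t = (u^2)_x`, `u^2_t = (((u^2)^2 + γ)/u^1)_x`. -/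
def systemRHS (γ : ℝ) : Fin 2 → DiffFun dom :=
  ![Dx u2, Dx ((u2 ^ 2 + algebraMap ℝ (DiffFun dom) γ) * invU1)]

/-- The contravariant metric `g^{(2,1)}`. -/
def g1 (γ : ℝ) (u : Fin 2 → ℝ) : Matrix (Fin 2) (Fin 2) ℝ :=
  !![-u 0, 0; 0, (u 1 ^ 2 + γ) / u 0]

/-- The contravariant metric `g^{(2,2)}`. -/
def g2 (u : Fin 2 → ℝ) : Matrix (Fin 2) (Fin 2) ℝ :=
  !![0, u 0; u 0, 2 * u 1]

/-- The contravariant metric `g^{(2,3)}`. -/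
def g3 (γ : ℝ) (u : Fin 2 → ℝ) : Matrix (Fin 2) (Fin 2) ℝ :=
  !![2 * u 1, (u 1 ^ 2 + γ) / u 0; (u 1 ^ 2 + γ) / u 0, 0]

/-- The third-order operator `R^{(2)} = D_x ∘ M ∘ D_x`, where `M` has the entries `0`,
`D_x ∘ (1/u^1)`; `(1/u^1) D_x`, `(u^2/(u^1)^2) D_x + D_x ∘ (u^2/(u^1)^2)`. -/
def R2 : MatDiffOp dom :=
  let M : MatDiffOp dom :=
    ![![0, opComp (opD dom) (opMul invU1)],
      ![opComp (opMul invU1) (opD dom),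
        opComp (opMul (u2 * invU1 ^ 2)) (opD dom) + opComp (opD dom) (opMul (u2 * invU1 ^ 2))]]
  fun i j => opComp (opD dom) (opComp (M i j) (opD dom))

end HamOp

end

open HamOp

noncomputable section

namespace HamOp

/-! ### Derivations of the algebra of differential functions -/

section Derivations

variable {n : ℕ} {Ω : TopologicalSpace.Opens (Fin n → ℝ)}

/-! Write u, v for the two fields, r = 1/u, s = v/u² and w = (v² + γ)/u. The first-order operators
are linear in u, v, w and their first derivatives, and R is linear in r, s and their derivatives.
Evolutionary derivations commute with D_x on these coefficients, so each linearization is the same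
operator with the coefficients replaced by their variations (`lin_op₁`, `lin_op₂`, `lin_op₃`,
`lin_R2`).

Modulo total derivatives, the pairing of a linearization with a covector can be integrated by parts
until the direction φ is undifferentiated. The form that remains is skew in the two covectors, hence
the Schouten bracket becomes an alternating trilinear form. Its vanishing modulo the image of D_x is
a polynomial identity in jet coordinates. The ten identities needed use only r u = 1 and the
derivatives of r and w, so they are proved in an abstract differential ring (`JetData`), where γ is
hidden in w. The six brackets of first-order operators vanish identically; the four that involve R
are D_x of explicit alternating forms.

The bracket is symmetric and bilinear, so these identities give both the Hamiltonian property and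
compatibility. The first operator is handled as 2P, which keeps its coefficients integral. What
remains is to compute the Levi-Civita coefficients and to exhibit the densities 2v, (v² − γ)/(2u)
and u, in the order of the metrics. -/

theorem dirDeriv_add (v : Jet n) {f g : JetOver Ω → ℝ} (hf : IsDiffFun Ω f) (hg : IsDiffFun Ω g) :
    dirDeriv v (f + g) = dirDeriv v f + dirDeriv v g := by
  obtain ⟨N, F, hF, hf⟩ := hf
  obtain ⟨M, G, hG, hg⟩ := hg
  obtain ⟨F', hF', hf'⟩ := IsDiffFun.raise (le_max_left N M) hF hf
  obtain ⟨G', hG', hg'⟩ := IsDiffFun.raise (le_max_right N M) hG hg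
  funext p
  have hmem := (isOpen_jetsOver Ω (max N M)).mem_nhds (show trunc (max N M) p.1 ∈ _ from p.2)
  have hdF := (hF'.contDiffAt hmem).differentiableAt (by simp)
  have hdG := (hG'.contDiffAt hmem).differentiableAt (by simp)
  rw [dirDeriv_eq (hF'.add hG') (fun p => by simp [hf' p, hg' p]), Pi.add_apply,
    dirDeriv_eq hF' hf', dirDeriv_eq hG' hg']
  change fderiv ℝ (F' + G') _ _ = _
  rw [fderiv_add hdF hdG]
  rfl

/-- Both factors factor through jets of a common finite order, where the product rule for Fréchet
derivatives on an open set applies. -/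
theorem dirDeriv_mul (v : Jet n) {f g : JetOver Ω → ℝ} (hf : IsDiffFun Ω f) (hg : IsDiffFun Ω g) :
    dirDeriv v (f * g) = f * dirDeriv v g + g * dirDeriv v f := by
  obtain ⟨N, F, hF, hf⟩ := hf
  obtain ⟨M, G, hG, hg⟩ := hg
  obtain ⟨F', hF', hf'⟩ := IsDiffFun.raise (le_max_left N M) hF hf
  obtain ⟨G', hG', hg'⟩ := IsDiffFun.raise (le_max_right N M) hG hg
  funext p
  have hmem := (isOpen_jetsOver Ω (max N M)).mem_nhds (show trunc (max N M) p.1 ∈ _ from p.2)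
  have hdF := (hF'.contDiffAt hmem).differentiableAt (by simp)
  have hdG := (hG'.contDiffAt hmem).differentiableAt (by simp)
  rw [dirDeriv_eq (hF'.mul hG') (fun p => by simp [hf' p, hg' p]), Pi.add_apply, Pi.mul_apply,
    Pi.mul_apply, dirDeriv_eq hF' hf', dirDeriv_eq hG' hg', hf' p, hg' p]
  change fderiv ℝ (F' * G') _ _ = _
  rw [fderiv_mul hdF hdG]
  rfl

theorem dirDeriv_const (v : Jet n) (c : ℝ) : dirDeriv v (fun _ : JetOver Ω => c) = 0 := by
  funext p
  rw [dirDeriv_eq (N := 0) (F := fun _ => c) contDiffOn_const (fun _ => rfl)]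
  simp

/-- The derivative along a constant vector, as a derivation of the differential functions. -/
def dirDer (v : Jet n) : Derivation ℝ (DiffFun Ω) (DiffFun Ω) :=
  Derivation.mk'
    { toFun := fun f => ⟨dirDeriv v f.1, isDiffFun_dirDeriv v f.2⟩
      map_add' := fun f g => Subtype.ext (dirDeriv_add v f.2 g.2)
      map_smul' := fun c f => Subtype.ext (by
        -- Homogeneity is the product rule with a constant factor, whose derivative is zero.
        have h := dirDeriv_mul v (algebraMap ℝ (DiffFun Ω) c).2 f.2
        have h0 : dirDeriv v (algebraMap ℝ (DiffFun Ω) c).1 = 0 := dirDeriv_const v c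
        rw [h0, mul_zero, add_zero] at h
        have e : (c • f).1 = (algebraMap ℝ (DiffFun Ω) c).1 * f.1 := by
          rw [Algebra.smul_def]; rfl
        change dirDeriv v (c • f).1 = _
        rw [e, h, RingHom.id_apply, Algebra.smul_def]
        rfl) }
    fun f g => Subtype.ext (dirDeriv_mul v f.2 g.2)

theorem dirDer_eq_pd (i : Fin n) (k : ℕ) (f : DiffFun Ω) :
    dirDer (0, Pi.single k (Pi.single i 1)) f = pd i k f := rfl

/-- A `finsum` with infinite support is zero by convention, so the additivity and Leibniz rules
below depend on this finiteness, which holds because f has finite order. -/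
theorem finite_support_pd_mul (f : DiffFun Ω) (i : Fin n) (c : ℕ → DiffFun Ω) :
    (Function.support fun k => pd i k f * c k).Finite := by
  obtain ⟨N, hN⟩ := exists_order f
  refine (Set.finite_Iic N).subset fun k hk => ?_
  by_contra h
  exact hk (by simp [hN i k (not_le.mp h)])

/-- The derivation `∑ c^i_k ∂/∂u^i_k`. -/
def vecField (c : Fin n → ℕ → DiffFun Ω) : Derivation ℝ (DiffFun Ω) (DiffFun Ω) :=
  Derivation.mk'
    { toFun := fun f => ∑ i, ∑ᶠ k, pd i k f * c i k
      map_add' := fun f g => by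
        rw [← Finset.sum_add_distrib]
        refine Finset.sum_congr rfl fun i _ => ?_
        rw [← finsum_add_distrib (finite_support_pd_mul f i _) (finite_support_pd_mul g i _)]
        simp only [← dirDer_eq_pd, map_add, add_mul]
      map_smul' := fun a f => by
        simp only [← dirDer_eq_pd, Derivation.map_smul, smul_mul_assoc, RingHom.id_apply, Finset.smul_sum]
        refine Finset.sum_congr rfl fun i _ => ?_
        rw [smul_finsum] }
    fun f g => by
      change ∑ i, ∑ᶠ k, pd i k (f * g) * c i k
        = f * (∑ i, ∑ᶠ k, pd i k g * c i k) + g * (∑ i, ∑ᶠ k, pd i k f * c i k)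
      rw [Finset.mul_sum, Finset.mul_sum, ← Finset.sum_add_distrib]
      refine Finset.sum_congr rfl fun i _ => ?_
      have hf := finite_support_pd_mul f i (c i)
      have hg := finite_support_pd_mul g i (c i)
      rw [mul_finsum' _ _ hg, mul_finsum' _ _ hf, ← finsum_add_distrib
        (hg.subset fun k hk h => hk (by simp only [h, mul_zero]))
        (hf.subset fun k hk h => hk (by simp only [h, mul_zero]))]
      refine finsum_congr fun k => ?_
      simp only [← dirDer_eq_pd, Derivation.leibniz, smul_eq_mul]
      ring

theorem vecField_apply (c : Fin n → ℕ → DiffFun Ω) (f : DiffFun Ω) :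
    vecField c f = ∑ i, ∑ᶠ k, pd i k f * c i k := rfl

/-- The total derivative as a derivation. -/
def totalDer (Ω : TopologicalSpace.Opens (Fin n → ℝ)) : Derivation ℝ (DiffFun Ω) (DiffFun Ω) :=
  dirDer (1, 0) + vecField fun i k => jetCoord Ω i (k + 1)

theorem Dx_eq (f : DiffFun Ω) : Dx f = totalDer Ω f := by
  simp only [Dx, totalDer, Derivation.add_apply, vecField_apply, mul_comm (jetCoord Ω _ _)]
  rfl

theorem iterate_Dx_eq (k : ℕ) (f : DiffFun Ω) :
    Dx^[k] f = ((totalDer Ω : DiffFun Ω →ₗ[ℝ] DiffFun Ω) ^ k) f := by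
  rw [Module.End.pow_apply]
  congr 1
  funext g
  exact Dx_eq g

/-- The evolutionary derivation with the characteristic `φ`. -/
def evol (φ : Fin n → DiffFun Ω) : Derivation ℝ (DiffFun Ω) (DiffFun Ω) :=
  vecField fun i k => Dx^[k] (φ i)

theorem evol_add (φ χ : Fin n → DiffFun Ω) : evol (φ + χ) = evol φ + evol χ := by
  ext1 f
  simp only [evol, vecField_apply, Derivation.add_apply, ← Finset.sum_add_distrib]
  refine Finset.sum_congr rfl fun i _ => ?_
  rw [← finsum_add_distrib (finite_support_pd_mul f i _) (finite_support_pd_mul f i _)]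
  simp only [iterate_Dx_eq, Pi.add_apply, map_add, mul_add]

theorem evol_smul (c : ℝ) (φ : Fin n → DiffFun Ω) : evol (c • φ) = c • evol φ := by
  ext1 f
  simp only [evol, vecField_apply, Derivation.smul_apply, Finset.smul_sum]
  refine Finset.sum_congr rfl fun i _ => ?_
  rw [smul_finsum]
  simp only [iterate_Dx_eq, Pi.smul_apply, map_smul, mul_smul_comm]

/-! ### Values of the derivations on jet coordinates. -/

theorem dirDer_jetCoord (v : Jet n) (i : Fin n) (k : ℕ) :
    dirDer v (jetCoord Ω i k) = algebraMap ℝ (DiffFun Ω) (v.2 k i) := by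
  refine Subtype.ext (funext fun p => ?_)
  let L : (ℝ × (Fin (k + 1) → Fin n → ℝ)) →L[ℝ] ℝ :=
    ((ContinuousLinearMap.proj (R := ℝ) (φ := fun _ : Fin n => ℝ) i).comp
      (ContinuousLinearMap.proj (R := ℝ) (φ := fun _ : Fin (k + 1) => Fin n → ℝ)
        (Fin.last k))).comp (ContinuousLinearMap.snd ℝ ℝ (Fin (k + 1) → Fin n → ℝ))
  change dirDeriv v (jetCoord Ω i k).1 p = _
  rw [dirDeriv_eq (f := (jetCoord Ω i k).1) (N := k) (F := L) L.contDiff.contDiffOn (fun _ => rfl), L.fderiv]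
  rfl

theorem pd_jetCoord (i j : Fin n) (k l : ℕ) :
    pd i k (jetCoord Ω j l) = if k = l ∧ i = j then 1 else 0 := by
  rw [← dirDer_eq_pd, dirDer_jetCoord]
  by_cases hk : k = l
  · subst hk
    by_cases hi : i = j
    · subst hi; simp
    · simp [hi, Ne.symm hi]
  · simp [hk, Ne.symm hk]

theorem vecField_jetCoord (c : Fin n → ℕ → DiffFun Ω) (j : Fin n) (l : ℕ) :
    vecField c (jetCoord Ω j l) = c j l := by
  rw [vecField_apply, Finset.sum_eq_single j, finsum_eq_single _ l]
  · simp [pd_jetCoord]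
  · intro k hk
    simp [pd_jetCoord, hk]
  · intro i _ hi
    simp [pd_jetCoord, hi]
  · simp

theorem Dx_jetCoord (j : Fin n) (l : ℕ) : Dx (jetCoord Ω j l) = jetCoord Ω j (l + 1) := by
  rw [Dx_eq, totalDer, Derivation.add_apply, vecField_jetCoord, dirDer_jetCoord]
  simp

theorem evol_jetCoord (φ : Fin n → DiffFun Ω) (j : Fin n) (l : ℕ) :
    evol φ (jetCoord Ω j l) = Dx^[l] (φ j) :=
  vecField_jetCoord _ j l

theorem varDeriv_ofBase (h : (Fin n → ℝ) → ℝ) (hh : ContDiffOn ℝ ∞ h Ω) (i : Fin n) :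
    varDeriv (ofBase h hh) i = pd i 0 (ofBase h hh) := by
  rw [varDeriv, finsum_eq_single _ 0]
  · simp
  · intro k hk
    have : pd i k (ofBase h hh) = 0 := by
      refine Subtype.ext (funext fun p => ?_)
      have hv : trunc 0 ((0, Pi.single k (Pi.single i 1)) : Jet n) = 0 := by
        refine Prod.ext rfl (funext fun l => ?_)
        have : (l : ℕ) ≠ k := by omega
        exact Pi.single_eq_of_ne this _
      change dirDeriv _ (ofBase h hh).1 p = 0
      rw [dirDeriv_eq (f := (ofBase h hh).1) (N := 0) (F := fun q => h (q.2 0))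
        (hh.comp (ContDiff.contDiffOn (by fun_prop)) (fun _ hq => hq)) (fun _ => rfl), hv, map_zero]
    rw [this, iterate_Dx_eq, map_zero, mul_zero]

end Derivations

/-! ### Linear combinations of operators -/

section Operators

variable {n : ℕ} {Ω : TopologicalSpace.Opens (Fin n → ℝ)}

/-- The value of a differential operator under an extension by additivity of a family of linear
maps that gives the values of the monomials `a D_x^k`. -/
def opEval (T : ℕ → DiffFun Ω →ₗ[ℝ] DiffFun Ω) : DiffOp Ω →ₗ[ℝ] DiffFun Ω :=
  Finsupp.lsum ℝ T

theorem opEval_apply (T : ℕ → DiffFun Ω →ₗ[ℝ] DiffFun Ω) (a : DiffOp Ω) :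
    opEval T a = a.sum fun k c => T k c := rfl

theorem opEval_single (T : ℕ → DiffFun Ω →ₗ[ℝ] DiffFun Ω) (k : ℕ) (c : DiffFun Ω) :
    opEval T (Finsupp.single k c) = T k c := by
  simp [opEval]

theorem app_eq (A : MatDiffOp Ω) (ψ : Fin n → DiffFun Ω) (i : Fin n) :
    A.app ψ i = ∑ j, opEval (fun k => LinearMap.mulRight ℝ (Dx^[k] (ψ j))) (A i j) := rfl

/-- The map `a ↦ (-D_x)^k (a f)`. -/
def adjMonomial (f : DiffFun Ω) (k : ℕ) : DiffFun Ω →ₗ[ℝ] DiffFun Ω where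
  toFun a := (-1) ^ k * Dx^[k] (a * f)
  map_add' a b := by simp only [iterate_Dx_eq, add_mul, map_add, mul_add]
  map_smul' c a := by
    simp only [iterate_Dx_eq, smul_mul_assoc, map_smul, mul_smul_comm, RingHom.id_apply]

theorem adjApp_eq (A : MatDiffOp Ω) (ψ : Fin n → DiffFun Ω) (i : Fin n) :
    A.adjApp ψ i = ∑ j, opEval (adjMonomial (ψ j)) (A j i) := rfl

/-- The sum over s and l is the evolutionary derivation with characteristic φ applied to the
coefficient. Linearizations can thus be computed by the Leibniz rule, without partial derivatives.
-/
theorem lin_eq (A : MatDiffOp Ω) (ψ φ : Fin n → DiffFun Ω) (i : Fin n) :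
    A.lin ψ φ i = ∑ j, opEval (fun k => LinearMap.mulRight ℝ (Dx^[k] (ψ j)) ∘ₗ
      (evol φ : DiffFun Ω →ₗ[ℝ] DiffFun Ω)) (A i j) := by
  refine Finset.sum_congr rfl fun j _ => Finsupp.sum_congr fun k _ => ?_
  change _ = (∑ s, ∑ᶠ l, pd s l (A i j k) * Dx^[l] (φ s)) * Dx^[k] (ψ j)
  rw [Finset.sum_mul]
  refine Finset.sum_congr rfl fun s _ => ?_
  rw [finsum_mul' _ _ (finite_support_pd_mul _ _ _)]
  exact finsum_congr fun l => mul_right_comm _ _ _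

theorem app_add (A B : MatDiffOp Ω) (ψ : Fin n → DiffFun Ω) :
    (A + B).app ψ = A.app ψ + B.app ψ := by
  funext i
  simp only [app_eq, Pi.add_apply, map_add, Finset.sum_add_distrib]

theorem app_smul (c : ℝ) (A : MatDiffOp Ω) (ψ : Fin n → DiffFun Ω) :
    (c • A).app ψ = c • A.app ψ := by
  funext i
  simp only [app_eq, Pi.smul_apply, map_smul, Finset.smul_sum]

theorem adjApp_add (A B : MatDiffOp Ω) (ψ : Fin n → DiffFun Ω) :
    (A + B).adjApp ψ = A.adjApp ψ + B.adjApp ψ := by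
  funext i
  simp only [adjApp_eq, Pi.add_apply, map_add, Finset.sum_add_distrib]

theorem adjApp_smul (c : ℝ) (A : MatDiffOp Ω) (ψ : Fin n → DiffFun Ω) :
    (c • A).adjApp ψ = c • A.adjApp ψ := by
  funext i
  simp only [adjApp_eq, Pi.smul_apply, map_smul, Finset.smul_sum]

theorem lin_add (A B : MatDiffOp Ω) (ψ φ : Fin n → DiffFun Ω) :
    (A + B).lin ψ φ = A.lin ψ φ + B.lin ψ φ := by
  funext i
  simp only [lin_eq, Pi.add_apply, map_add, Finset.sum_add_distrib]

theorem lin_smul (c : ℝ) (A : MatDiffOp Ω) (ψ φ : Fin n → DiffFun Ω) :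
    (c • A).lin ψ φ = c • A.lin ψ φ := by
  funext i
  simp only [lin_eq, Pi.smul_apply, map_smul, Finset.smul_sum]

theorem lin_add_right (A : MatDiffOp Ω) (ψ φ χ : Fin n → DiffFun Ω) :
    A.lin ψ (φ + χ) = A.lin ψ φ + A.lin ψ χ := by
  funext i
  simp only [lin_eq, opEval_apply, LinearMap.comp_apply, Derivation.coeFn_coe, evol_add,
    Derivation.add_apply, map_add, Finsupp.sum_add, Finset.sum_add_distrib, Pi.add_apply]

theorem lin_smul_right (A : MatDiffOp Ω) (c : ℝ) (ψ φ : Fin n → DiffFun Ω) :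
    A.lin ψ (c • φ) = c • A.lin ψ φ := by
  funext i
  simp only [lin_eq, opEval_apply, LinearMap.comp_apply, Derivation.coeFn_coe, evol_smul,
    Derivation.smul_apply, map_smul, ← Finsupp.smul_sum, Finset.smul_sum, Pi.smul_apply]

theorem pair_add (φ χ ψ : Fin n → DiffFun Ω) : pair (φ + χ) ψ = pair φ ψ + pair χ ψ := by
  simp only [pair, Pi.add_apply, add_mul, Finset.sum_add_distrib]

theorem pair_smul (c : ℝ) (φ ψ : Fin n → DiffFun Ω) : pair (c • φ) ψ = c • pair φ ψ := by
  simp only [pair, Pi.smul_apply, smul_mul_assoc, Finset.smul_sum]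

/-! ### Symmetry and bilinearity of the Schouten bracket. -/

theorem SchoutenVanishes.symm {A B : MatDiffOp Ω} (h : SchoutenVanishes A B) :
    SchoutenVanishes B A := by
  intro ψ₁ ψ₂ ψ₃
  obtain ⟨χ, hχ⟩ := h ψ₁ ψ₂ ψ₃
  exact ⟨χ, by rw [← hχ, schouten, schouten, add_comm]⟩

theorem SchoutenVanishes.add {A B C : MatDiffOp Ω} (hA : SchoutenVanishes A C)
    (hB : SchoutenVanishes B C) : SchoutenVanishes (A + B) C := by
  intro ψ₁ ψ₂ ψ₃
  obtain ⟨χ, hχ⟩ := hA ψ₁ ψ₂ ψ₃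
  obtain ⟨η, hη⟩ := hB ψ₁ ψ₂ ψ₃
  refine ⟨χ + η, ?_⟩
  rw [Dx_eq, map_add, ← Dx_eq, ← Dx_eq, ← hχ, ← hη]
  simp only [schouten, app_add, lin_add, lin_add_right, pair_add]
  ring

theorem SchoutenVanishes.smul {A C : MatDiffOp Ω} (hA : SchoutenVanishes A C) (c : ℝ) :
    SchoutenVanishes (c • A) C := by
  intro ψ₁ ψ₂ ψ₃
  obtain ⟨χ, hχ⟩ := hA ψ₁ ψ₂ ψ₃
  refine ⟨c • χ, ?_⟩
  rw [Dx_eq, Derivation.map_smul, ← Dx_eq, ← hχ]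
  simp only [schouten, app_smul, lin_smul, lin_smul_right, pair_smul, smul_add]

theorem IsHamiltonian.smul {A : MatDiffOp Ω} (hA : IsHamiltonian A) (c : ℝ) :
    IsHamiltonian (c • A) :=
  ⟨fun ψ => by rw [adjApp_smul, app_smul, hA.1, smul_neg], (hA.2.smul c).symm.smul c⟩

/-- Polarization: [A + B, A + B] is assembled from [A, A], [A, B] and [B, B], with linearity used in
one slot at a time and symmetry to exchange the slots. -/
theorem IsHamiltonian.add {A B : MatDiffOp Ω} (hA : IsHamiltonian A) (hB : IsHamiltonian B)
    (h : SchoutenVanishes A B) : IsHamiltonian (A + B) :=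
  ⟨fun ψ => by rw [adjApp_add, app_add, hA.1, hB.1, neg_add],
    (hA.2.add h.symm).symm.add (h.add hB.2).symm⟩

theorem IsHamiltonian.compatible {A B : MatDiffOp Ω} (hA : IsHamiltonian A) (hB : IsHamiltonian B)
    (h : SchoutenVanishes A B) : Compatible A B :=
  ⟨hA, hB, fun c => hA.add (hB.smul c) (h.symm.smul c).symm⟩

end Operators

/-! ### First- and third-order operators in a differential ring -/

section DifferentialRing

variable {A : Type*} [CommRing A] [Algebra ℝ A]

theorem derivation_ofNat (D : Derivation ℝ A A) (n : ℕ) [n.AtLeastTwo] :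
    D (ofNat(n) : A) = 0 :=
  D.map_natCast n

/-- The operator `2 P^{(2,1)}`, where `w = ((u^2)^2 + γ)/u^1`; it is linear in `(u, v, w)`. -/
def app₁ (D : Derivation ℝ A A) (u v w : A) (ψ : Fin 2 → A) : Fin 2 → A :=
  ![-2 * u * D (ψ 0) - D u * ψ 0 + D v * ψ 1, -D v * ψ 0 + 2 * w * D (ψ 1) + D w * ψ 1]

/-- The operator `P^{(2,2)}`; it is linear in `(u, v)`. -/
def app₂ (D : Derivation ℝ A A) (u v : A) (ψ : Fin 2 → A) : Fin 2 → A :=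
  ![u * D (ψ 1) + D u * ψ 1, u * D (ψ 0) + 2 * v * D (ψ 1) + D v * ψ 1]

/-- The operator `P^{(2,3)}`; it is linear in `(v, w)`. -/
def app₃ (D : Derivation ℝ A A) (v w : A) (ψ : Fin 2 → A) : Fin 2 → A :=
  ![2 * v * D (ψ 0) + D v * ψ 0 + w * D (ψ 1), w * D (ψ 0) + D w * ψ 0]

/-- The operator `R^{(2)}`, where `r = 1/u^1` and `s = u^2/(u^1)^2`; it is linear in `(r, s)`. -/
def appR (D : Derivation ℝ A A) (r s : A) (ψ : Fin 2 → A) : Fin 2 → A :=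
  ![D (D (r * D (ψ 1))), D (r * D (D (ψ 0)) + s * D (D (ψ 1)) + D (s * D (ψ 1)))]

/-- The variation of `1/u^1` in the direction `φ`. -/
def varR (r : A) (φ : Fin 2 → A) : A := -r ^ 2 * φ 0

/-- The variation of `u^2/(u^1)^2` in the direction `φ`. -/
def varS (v r : A) (φ : Fin 2 → A) : A := r ^ 2 * φ 1 - 2 * v * r ^ 3 * φ 0

/-- The variation of `((u^2)^2 + γ)/u^1` in the direction `φ`. -/
def varW (v r w : A) (φ : Fin 2 → A) : A := r * (2 * v * φ 1 - w * φ 0)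

/-- The Schouten bracket of two operators `FA`, `FB`, where `BA ψ φ θ` stands for the pairing of
`ℓ_{A,ψ}(φ)` with `θ`. -/
def bracket (BA BB : (Fin 2 → A) → (Fin 2 → A) → (Fin 2 → A) → A) (FA FB : (Fin 2 → A) → Fin 2 → A)
    (ψ : Fin 3 → Fin 2 → A) : A :=
  (BA (ψ 0) (FB (ψ 1)) (ψ 2) + BA (ψ 1) (FB (ψ 2)) (ψ 0) + BA (ψ 2) (FB (ψ 0)) (ψ 1))
    + (BB (ψ 0) (FA (ψ 1)) (ψ 2) + BB (ψ 1) (FA (ψ 2)) (ψ 0) + BB (ψ 2) (FA (ψ 0)) (ψ 1))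

/-- Total derivatives may be dropped from the linearizations. -/
theorem bracket_eq {D : Derivation ℝ A A}
    {BA BB BA' BB' CA CB : (Fin 2 → A) → (Fin 2 → A) → (Fin 2 → A) → A}
    {FA FB : (Fin 2 → A) → Fin 2 → A} {ψ : Fin 3 → Fin 2 → A} (hA : ∀ ψ φ θ, BA ψ φ θ = BA' ψ φ θ + D (CA ψ φ θ))
    (hB : ∀ ψ φ θ, BB ψ φ θ = BB' ψ φ θ + D (CB ψ φ θ))
    (h : ∃ χ, bracket BA' BB' FA FB ψ = D χ) : ∃ χ, bracket BA BB FA FB ψ = D χ := by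
  obtain ⟨χ, h⟩ := h
  refine ⟨χ + bracket CA CB FA FB ψ, ?_⟩
  rw [map_add, ← h]
  simp only [bracket, hA, hB, map_add]
  ring

/-- A differential ring with the jet coordinates `u_k`, `v_k` of two field variables, with
`r = 1/u`, with `w = (v^2 + γ)/u`, and with the derivatives `p_k`, `q_k` of the components of three
covectors. -/
structure JetData (A : Type*) [CommRing A] [Algebra ℝ A] where
  D : Derivation ℝ A A
  (u v : ℕ → A)
  (r w : A)
  (p q : ℕ → Fin 3 → A)
  D_u : ∀ k, D (u k) = u (k + 1)
  D_v : ∀ k, D (v k) = v (k + 1)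
  D_r : D r = -r ^ 2 * u 1
  D_w : D w = 2 * r * v 0 * v 1 - r * w * u 1
  D_p : ∀ k a, D (p k a) = p (k + 1) a
  D_q : ∀ k a, D (q k a) = q (k + 1) a
  r_mul_u : r * u 0 = 1

namespace JetData

variable (J : JetData A)

/-- The three covectors. -/
def covector (a : Fin 3) : Fin 2 → A := ![J.p 0 a, J.q 0 a]

def F₁ : (Fin 2 → A) → Fin 2 → A := app₁ J.D (J.u 0) (J.v 0) J.w

def F₂ : (Fin 2 → A) → Fin 2 → A := app₂ J.D (J.u 0) (J.v 0)

def F₃ : (Fin 2 → A) → Fin 2 → A := app₃ J.D (J.v 0) J.w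

def FR : (Fin 2 → A) → Fin 2 → A := appR J.D J.r (J.v 0 * J.r ^ 2)

def L₁ (ψ φ : Fin 2 → A) : Fin 2 → A := app₁ J.D (φ 0) (φ 1) (varW (J.v 0) J.r J.w φ) ψ

def L₂ (ψ φ : Fin 2 → A) : Fin 2 → A := app₂ J.D (φ 0) (φ 1) ψ

def L₃ (ψ φ : Fin 2 → A) : Fin 2 → A := app₃ J.D (φ 1) (varW (J.v 0) J.r J.w φ) ψ

def LR (ψ φ : Fin 2 → A) : Fin 2 → A := appR J.D (varR J.r φ) (varS (J.v 0) J.r φ) ψ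

/-- The pairing of `L₁ ψ φ` with `θ`, up to a total derivative. -/
def B₁ (ψ φ θ : Fin 2 → A) : A :=
  φ 0 * (ψ 0 * J.D (θ 0) - θ 0 * J.D (ψ 0)) + φ 1 * J.D (ψ 0 * θ 1 - ψ 1 * θ 0)
    + varW (J.v 0) J.r J.w φ * (θ 1 * J.D (ψ 1) - ψ 1 * J.D (θ 1))

/-- The pairing of `L₂ ψ φ` with `θ`, up to a total derivative. -/
def B₂ (ψ φ θ : Fin 2 → A) : A :=
  φ 0 * (θ 1 * J.D (ψ 0) - ψ 1 * J.D (θ 0)) + φ 1 * (θ 1 * J.D (ψ 1) - ψ 1 * J.D (θ 1))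

/-- The pairing of `L₃ ψ φ` with `θ`, up to a total derivative. -/
def B₃ (ψ φ θ : Fin 2 → A) : A :=
  φ 1 * (θ 0 * J.D (ψ 0) - ψ 0 * J.D (θ 0))
    + varW (J.v 0) J.r J.w φ * (θ 0 * J.D (ψ 1) - ψ 0 * J.D (θ 1))

/-- The pairing of `LR ψ φ` with `θ`, up to a total derivative. -/
def BR (ψ φ θ : Fin 2 → A) : A :=
  varR J.r φ * (J.D (ψ 1) * J.D (J.D (θ 0)) - J.D (J.D (ψ 0)) * J.D (θ 1))
    + varS (J.v 0) J.r φ * (J.D (ψ 1) * J.D (J.D (θ 1)) - J.D (J.D (ψ 1)) * J.D (θ 1))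

/-- Integration by parts, as in the three lemmas that follow. In the remaining form φ is not
differentiated, so no derivative falls on the operator value substituted for it; and the form is
skew in ψ and θ, which makes the bracket alternating. -/
theorem pairing_L₁ (ψ φ θ : Fin 2 → A) : ∑ i, J.L₁ ψ φ i * θ i = J.B₁ ψ φ θ
    + J.D (φ 1 * (ψ 1 * θ 0 - ψ 0 * θ 1) - φ 0 * ψ 0 * θ 0
      + varW (J.v 0) J.r J.w φ * ψ 1 * θ 1) := by
  simp only [L₁, app₁, B₁, Fin.sum_univ_two, Matrix.cons_val_zero, Matrix.cons_val_one, map_add,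
    map_sub, Derivation.leibniz, smul_eq_mul]
  ring

theorem pairing_L₂ (ψ φ θ : Fin 2 → A) : ∑ i, J.L₂ ψ φ i * θ i = J.B₂ ψ φ θ
    + J.D (φ 0 * ψ 1 * θ 0 + φ 1 * ψ 1 * θ 1) := by
  simp only [L₂, app₂, B₂, Fin.sum_univ_two, Matrix.cons_val_zero, Matrix.cons_val_one, map_add,
    Derivation.leibniz, smul_eq_mul]
  ring

theorem pairing_L₃ (ψ φ θ : Fin 2 → A) : ∑ i, J.L₃ ψ φ i * θ i = J.B₃ ψ φ θ
    + J.D (φ 1 * ψ 0 * θ 0 + varW (J.v 0) J.r J.w φ * ψ 0 * θ 1) := by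
  simp only [L₃, app₃, B₃, Fin.sum_univ_two, Matrix.cons_val_zero, Matrix.cons_val_one, map_add,
    Derivation.leibniz, smul_eq_mul]
  ring

theorem pairing_LR (ψ φ θ : Fin 2 → A) : ∑ i, J.LR ψ φ i * θ i = J.BR ψ φ θ
    + J.D (J.D (varR J.r φ * J.D (ψ 1)) * θ 0 - varR J.r φ * J.D (ψ 1) * J.D (θ 0)
      + (varR J.r φ * J.D (J.D (ψ 0)) + varS (J.v 0) J.r φ * J.D (J.D (ψ 1))
        + J.D (varS (J.v 0) J.r φ * J.D (ψ 1))) * θ 1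
      - varS (J.v 0) J.r φ * J.D (ψ 1) * J.D (θ 1)) := by
  simp only [LR, appR, BR, Fin.sum_univ_two, Matrix.cons_val_zero, Matrix.cons_val_one, map_add,
    map_sub, Derivation.leibniz, smul_eq_mul]
  ring

/-- Here and in the five lemmas that follow, a factor r of the variation meets a factor u of the
operator. Cancelling them now is the only use of r u = 1 in the bracket computations. -/
theorem varW_F₁ (ψ : Fin 2 → A) : varW (J.v 0) J.r J.w (J.F₁ ψ) =
    2 * J.v 0 * J.r * J.F₁ ψ 1 -
      J.w * (-2 * J.D (ψ 0) - J.r * J.u 1 * ψ 0 + J.r * J.v 1 * ψ 1) := by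
  simp only [varW, F₁, app₁, J.D_u, J.D_v, Matrix.cons_val_zero]
  linear_combination (2 * J.w * J.D (ψ 0)) * J.r_mul_u

theorem varW_F₂ (ψ : Fin 2 → A) : varW (J.v 0) J.r J.w (J.F₂ ψ) =
    2 * J.v 0 * (J.D (ψ 0) + 2 * J.v 0 * J.r * J.D (ψ 1) + J.r * J.v 1 * ψ 1) -
      J.w * (J.D (ψ 1) + J.r * J.u 1 * ψ 1) := by
  simp only [varW, F₂, app₂, J.D_u, J.D_v, Matrix.cons_val_zero, Matrix.cons_val_one]
  linear_combination (2 * J.v 0 * J.D (ψ 0) - J.w * J.D (ψ 1)) * J.r_mul_u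

theorem varR_F₁ (ψ : Fin 2 → A) : varR J.r (J.F₁ ψ) =
    -J.r * (-2 * J.D (ψ 0) - J.r * J.u 1 * ψ 0 + J.r * J.v 1 * ψ 1) := by
  simp only [varR, F₁, app₁, J.D_u, J.D_v, Matrix.cons_val_zero]
  linear_combination (2 * J.r * J.D (ψ 0)) * J.r_mul_u

theorem varR_F₂ (ψ : Fin 2 → A) : varR J.r (J.F₂ ψ) =
    -J.r * (J.D (ψ 1) + J.r * J.u 1 * ψ 1) := by
  simp only [varR, F₂, app₂, J.D_u, Matrix.cons_val_zero]
  linear_combination (-J.r * J.D (ψ 1)) * J.r_mul_u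

theorem varS_F₁ (ψ : Fin 2 → A) : varS (J.v 0) J.r (J.F₁ ψ) =
    J.r ^ 2 * J.F₁ ψ 1 - 2 * J.v 0 * J.r ^ 2 *
      (-2 * J.D (ψ 0) - J.r * J.u 1 * ψ 0 + J.r * J.v 1 * ψ 1) := by
  simp only [varS, F₁, app₁, J.D_u, J.D_v, Matrix.cons_val_zero]
  linear_combination (4 * J.v 0 * J.r ^ 2 * J.D (ψ 0)) * J.r_mul_u

theorem varS_F₂ (ψ : Fin 2 → A) : varS (J.v 0) J.r (J.F₂ ψ) =
    J.r * (J.D (ψ 0) + J.r * J.v 1 * ψ 1) - 2 * J.v 0 * J.r ^ 3 * J.u 1 * ψ 1 := by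
  simp only [varS, F₂, app₂, J.D_u, J.D_v, Matrix.cons_val_zero, Matrix.cons_val_one]
  linear_combination (J.r * J.D (ψ 0) - 2 * J.v 0 * J.r ^ 2 * J.D (ψ 1)) * J.r_mul_u

/-- The alternating trilinear form of three components of three covectors. -/
def wedge (x y z : Fin 3 → A) : A :=
  x 0 * (y 1 * z 2 - z 1 * y 2) + x 1 * (y 2 * z 0 - z 2 * y 0) + x 2 * (y 0 * z 1 - z 0 * y 1)

theorem derivation_wedge (D : Derivation ℝ A A) (x y z : Fin 3 → A) :
    D (wedge x y z) = wedge (fun a => D (x a)) y z + wedge x (fun a => D (y a)) z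
      + wedge x y (fun a => D (z a)) := by
  simp only [wedge, map_add, map_sub, Derivation.leibniz, smul_eq_mul]
  ring

/-! ### The Schouten brackets as polynomial identities. -/

theorem bracket₁₁ : ∃ χ : A, bracket J.B₁ J.B₁ J.F₁ J.F₁ J.covector = J.D χ := by
  simp only [bracket, B₁, varW_F₁]
  simp only [F₁, app₁, covector, Matrix.cons_val_zero, Matrix.cons_val_one]
  -- The relation r u = 1 is discarded: what is left holds with u, v, r, w, p, q and their
  -- derivatives as independent symbols.
  obtain ⟨D, u, v, r, w, p, q, D_u, D_v, D_r, D_w, D_p, D_q, -⟩ := J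
  -- After the integration by parts no divergence is left, as in all the brackets of two first-order
  -- operators.
  refine ⟨0, ?_⟩
  simp only [map_sub, map_zero, Derivation.leibniz, D_u, D_v,
    D_w, D_p, D_q, smul_eq_mul]
  ring

theorem bracket₂₂ : ∃ χ : A, bracket J.B₂ J.B₂ J.F₂ J.F₂ J.covector = J.D χ := by
  simp only [bracket, B₂]
  simp only [F₂, app₂, covector, Matrix.cons_val_zero, Matrix.cons_val_one]
  obtain ⟨D, u, v, r, w, p, q, D_u, D_v, D_r, D_w, D_p, D_q, -⟩ := J
  refine ⟨0, ?_⟩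
  simp only [map_zero, D_u, D_v,
    D_p, D_q]
  ring

theorem bracket₃₃ : ∃ χ : A, bracket J.B₃ J.B₃ J.F₃ J.F₃ J.covector = J.D χ := by
  simp only [bracket, B₃]
  simp only [varW, F₃, app₃, covector, Matrix.cons_val_zero, Matrix.cons_val_one]
  obtain ⟨D, u, v, r, w, p, q, D_u, D_v, D_r, D_w, D_p, D_q, -⟩ := J
  refine ⟨0, ?_⟩
  simp only [map_zero, D_v,
    D_w, D_p, D_q]
  ring

theorem bracket₁₂ : ∃ χ : A, bracket J.B₁ J.B₂ J.F₁ J.F₂ J.covector = J.D χ := by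
  simp only [bracket, B₁, B₂, varW_F₂]
  simp only [F₁, F₂, app₁, app₂, covector, Matrix.cons_val_zero, Matrix.cons_val_one]
  obtain ⟨D, u, v, r, w, p, q, D_u, D_v, D_r, D_w, D_p, D_q, -⟩ := J
  refine ⟨0, ?_⟩
  simp only [map_sub, map_zero, Derivation.leibniz, D_u, D_v,
    D_w, D_p, D_q, smul_eq_mul]
  ring

theorem bracket₁₃ : ∃ χ : A, bracket J.B₁ J.B₃ J.F₁ J.F₃ J.covector = J.D χ := by
  simp only [bracket, B₁, B₃, varW_F₁]
  simp only [varW, F₁, F₃, app₁, app₃, covector, Matrix.cons_val_zero, Matrix.cons_val_one]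
  obtain ⟨D, u, v, r, w, p, q, D_u, D_v, D_r, D_w, D_p, D_q, -⟩ := J
  refine ⟨0, ?_⟩
  simp only [map_sub, map_zero, Derivation.leibniz, D_v,
    D_w, D_p, D_q, smul_eq_mul]
  ring

theorem bracket₂₃ : ∃ χ : A, bracket J.B₂ J.B₃ J.F₂ J.F₃ J.covector = J.D χ := by
  simp only [bracket, B₂, B₃, varW_F₂]
  simp only [F₂, F₃, app₂, app₃, covector, Matrix.cons_val_zero, Matrix.cons_val_one]
  obtain ⟨D, u, v, r, w, p, q, D_u, D_v, D_r, D_w, D_p, D_q, -⟩ := J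
  refine ⟨0, ?_⟩
  simp only [map_zero, D_v,
    D_w, D_p, D_q]
  ring

set_option maxRecDepth 2000 in
theorem bracket₁R : ∃ χ : A, bracket J.B₁ J.BR J.F₁ J.FR J.covector = J.D χ := by
  simp only [bracket, B₁, BR, varR_F₁, varS_F₁]
  simp only [varW, F₁, FR, app₁, appR, covector, Matrix.cons_val_zero, Matrix.cons_val_one]
  obtain ⟨D, u, v, r, w, p, q, D_u, D_v, D_r, D_w, D_p, D_q, -⟩ := J
  -- The bracket is alternating and each of its terms contains four x-derivatives, so its primitive
  -- is sought among the alternating forms with three, counting those on the coefficients.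
  refine ⟨r ^ 2 * u 1 * wedge (p 0) (p 1) (q 1) - r * wedge (p 0) (p 1) (q 2)
    + r * wedge (p 0) (p 2) (q 1) - 2 * r ^ 2 * v 0 * wedge (p 0) (q 1) (q 2)
    + r * wedge (p 1) (p 2) (q 0)
    + (2 * r ^ 3 * u 1 * v 0 - r ^ 2 * v 1) * wedge (p 1) (q 0) (q 1)
    - 2 * r ^ 2 * v 0 * wedge (p 1) (q 0) (q 2) + 2 * r ^ 2 * v 0 * wedge (p 2) (q 0) (q 1)
    + (4 * r ^ 3 * v 0 ^ 2 - r ^ 2 * w) * wedge (q 0) (q 1) (q 2), ?_⟩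
  -- The derivative is taken while the forms are still closed; they are expanded into components
  -- only afterwards.
  simp only [derivation_wedge, map_add, map_sub, map_neg, Derivation.leibniz,
    Derivation.leibniz_pow, derivation_ofNat, D_u, D_v, D_r, D_w, D_p, D_q, smul_eq_mul,
    nsmul_eq_mul, Nat.cast_ofNat]
  simp only [wedge]
  ring

theorem bracket₂R : ∃ χ : A, bracket J.B₂ J.BR J.F₂ J.FR J.covector = J.D χ := by
  simp only [bracket, B₂, BR, varR_F₂, varS_F₂]
  simp only [FR, appR, covector, Matrix.cons_val_zero, Matrix.cons_val_one]
  obtain ⟨D, u, v, r, w, p, q, D_u, D_v, D_r, D_w, D_p, D_q, -⟩ := J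
  refine ⟨r ^ 2 * u 1 * wedge (p 1) (q 0) (q 1) - r * wedge (p 1) (q 0) (q 2)
    + r * wedge (p 2) (q 0) (q 1) + 2 * r ^ 2 * v 0 * wedge (q 0) (q 1) (q 2), ?_⟩
  simp only [derivation_wedge, map_add, map_sub, map_neg, Derivation.leibniz,
    Derivation.leibniz_pow, derivation_ofNat, D_u, D_v, D_r, D_p, D_q, smul_eq_mul,
    nsmul_eq_mul, Nat.cast_ofNat]
  simp only [wedge]
  ring

theorem bracket₃R : ∃ χ : A, bracket J.B₃ J.BR J.F₃ J.FR J.covector = J.D χ := by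
  simp only [bracket, B₃, BR]
  simp only [varW, varR, varS, F₃, FR, app₃, appR, covector, Matrix.cons_val_zero,
    Matrix.cons_val_one]
  obtain ⟨D, u, v, r, w, p, q, D_u, D_v, D_r, D_w, D_p, D_q, -⟩ := J
  refine ⟨r * wedge (p 0) (p 1) (p 2)
    + (r ^ 2 * v 1 - 2 * r ^ 3 * u 1 * v 0) * wedge (p 0) (p 1) (q 1)
    + 2 * r ^ 2 * v 0 * wedge (p 0) (p 1) (q 2) - 2 * r ^ 2 * v 0 * wedge (p 0) (p 2) (q 1)
    + (4 * r ^ 3 * v 0 ^ 2 - r ^ 2 * w) * wedge (p 0) (q 1) (q 2), ?_⟩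
  simp only [derivation_wedge, map_add, map_sub, map_neg, Derivation.leibniz,
    Derivation.leibniz_pow, derivation_ofNat, D_u, D_v, D_r, D_w, D_p, D_q, smul_eq_mul,
    nsmul_eq_mul, Nat.cast_ofNat]
  simp only [wedge]
  ring

theorem bracketRR : ∃ χ : A, bracket J.BR J.BR J.FR J.FR J.covector = J.D χ := by
  simp only [bracket, BR]
  simp only [varR, varS, FR, appR, covector, Matrix.cons_val_zero, Matrix.cons_val_one]
  obtain ⟨D, u, v, r, w, p, q, D_u, D_v, D_r, D_w, D_p, D_q, -⟩ := J
  -- Two third-order operators give six x-derivatives; a single alternating form with five of them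
  -- suffices.
  refine ⟨-(2 * r ^ 3 * wedge (p 2) (q 1) (q 2)), ?_⟩
  simp only [derivation_wedge, map_add, map_neg, Derivation.leibniz,
    Derivation.leibniz_pow, derivation_ofNat, D_u, D_v, D_r, D_p, D_q, smul_eq_mul,
    nsmul_eq_mul, Nat.cast_ofNat]
  simp only [wedge]
  ring

end JetData

end DifferentialRing

/-! ### The operators of the two-component system -/

section TwoComponents

theorem totalDer_jetCoord (j : Fin 2) (l : ℕ) :
    totalDer dom (jetCoord dom j l) = jetCoord dom j (l + 1) := by
  rw [← Dx_eq, Dx_jetCoord]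

theorem invU1_mul : invU1 * jetCoord dom 0 0 = 1 :=
  Subtype.ext (funext fun p => inv_mul_cancel₀ p.2)

/-- The Leibniz rule for r u = 1 forces the value of every derivation on r; this serves total,
evolutionary and partial derivatives alike. -/
theorem derivation_invU1 (D : Derivation ℝ (DiffFun dom) (DiffFun dom)) :
    D invU1 = -invU1 ^ 2 * D (jetCoord dom 0 0) := by
  rw [D.leibniz_of_mul_eq_one invU1_mul, smul_eq_mul]

theorem totalDer_invU1 : totalDer dom invU1 = -invU1 ^ 2 * jetCoord dom 0 1 := by
  rw [derivation_invU1, totalDer_jetCoord]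

theorem evol_invU1 (φ : Fin 2 → DiffFun dom) : evol φ invU1 = -invU1 ^ 2 * φ 0 := by
  rw [derivation_invU1, evol_jetCoord, Function.iterate_zero, id]

/-- The function `((u^2)^2 + γ)/u^1`. -/
def wFun (γ : ℝ) : DiffFun dom := (u2 ^ 2 + algebraMap ℝ (DiffFun dom) γ) * invU1

theorem derivation_wFun (γ : ℝ) (D : Derivation ℝ (DiffFun dom) (DiffFun dom)) :
    D (wFun γ) =
      invU1 * (2 * jetCoord dom 1 0 * D (jetCoord dom 1 0) - wFun γ * D (jetCoord dom 0 0)) := by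
  simp only [wFun, u2, Derivation.leibniz, Derivation.leibniz_pow, map_add,
    Derivation.map_algebraMap, derivation_invU1, smul_eq_mul, nsmul_eq_mul]
  push_cast
  ring

theorem totalDer_wFun (γ : ℝ) : totalDer dom (wFun γ) =
    2 * invU1 * jetCoord dom 1 0 * jetCoord dom 1 1 - invU1 * wFun γ * jetCoord dom 0 1 := by
  rw [derivation_wFun, totalDer_jetCoord, totalDer_jetCoord]
  ring

/-- Three covectors over the domain `u^1 ≠ 0`. -/
def jetData (γ : ℝ) (ψ : Fin 3 → Fin 2 → DiffFun dom) : JetData (DiffFun dom) where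
  D := totalDer dom
  u := jetCoord dom 0
  v := jetCoord dom 1
  r := invU1
  w := wFun γ
  p k a := Dx^[k] (ψ a 0)
  q k a := Dx^[k] (ψ a 1)
  D_u := totalDer_jetCoord 0
  D_v := totalDer_jetCoord 1
  D_r := totalDer_invU1
  D_w := totalDer_wFun γ
  D_p k a := by rw [Function.iterate_succ_apply', Dx_eq]
  D_q k a := by rw [Function.iterate_succ_apply', Dx_eq]
  r_mul_u := invU1_mul

theorem covector_jetData (γ : ℝ) (ψ : Fin 3 → Fin 2 → DiffFun dom) :
    (jetData γ ψ).covector = ψ := by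
  funext a i
  fin_cases i <;> rfl

/-- The operator `a D_x + b`. -/
def firstOrder (a b : DiffFun dom) : DiffOp dom := Finsupp.single 1 a + Finsupp.single 0 b

theorem opEval_firstOrder (T : ℕ → DiffFun dom →ₗ[ℝ] DiffFun dom) (a b : DiffFun dom) :
    opEval T (firstOrder a b) = T 1 a + T 0 b := by
  rw [firstOrder, map_add, opEval_single, opEval_single]

/-- The operator `2 P^{(2,1)}`. -/
def op₁ (γ : ℝ) : MatDiffOp dom :=
  ![![firstOrder (-2 * jetCoord dom 0 0) (-jetCoord dom 0 1),
      firstOrder 0 (jetCoord dom 1 1)],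
    ![firstOrder 0 (-jetCoord dom 1 1),
      firstOrder (2 * wFun γ) (Dx (wFun γ))]]

/-- The operator `P^{(2,2)}`. -/
def op₂ : MatDiffOp dom :=
  ![![0, firstOrder (jetCoord dom 0 0) (jetCoord dom 0 1)],
    ![firstOrder (jetCoord dom 0 0) 0,
      firstOrder (2 * jetCoord dom 1 0) (jetCoord dom 1 1)]]

/-- The operator `P^{(2,3)}`. -/
def op₃ (γ : ℝ) : MatDiffOp dom :=
  ![![firstOrder (2 * jetCoord dom 1 0) (jetCoord dom 1 1),
      firstOrder (wFun γ) 0],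
    ![firstOrder (wFun γ) (Dx (wFun γ)), 0]]

theorem app_op₁ (γ : ℝ) (ψ : Fin 2 → DiffFun dom) : (op₁ γ).app ψ =
    app₁ (totalDer dom) (jetCoord dom 0 0) (jetCoord dom 1 0) (wFun γ) ψ := by
  funext i
  fin_cases i <;>
  · simp [app_eq, op₁, app₁, opEval_firstOrder, Dx_eq, totalDer_jetCoord]
    ring

theorem app_op₂ (ψ : Fin 2 → DiffFun dom) : op₂.app ψ =
    app₂ (totalDer dom) (jetCoord dom 0 0) (jetCoord dom 1 0) ψ := by
  funext i
  fin_cases i <;>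
  · simp [app_eq, op₂, app₂, opEval_firstOrder, Dx_eq, totalDer_jetCoord]
    try ring

theorem app_op₃ (γ : ℝ) (ψ : Fin 2 → DiffFun dom) : (op₃ γ).app ψ =
    app₃ (totalDer dom) (jetCoord dom 1 0) (wFun γ) ψ := by
  funext i
  fin_cases i <;>
  · simp [app_eq, op₃, app₃, opEval_firstOrder, Dx_eq, totalDer_jetCoord]
    try ring

/-- For operators g D_x + b, skew-adjointness means that g is symmetric and that b plus its
transpose is D_x g. The same holds for the other two operators. -/
theorem adjApp_op₁ (γ : ℝ) (ψ : Fin 2 → DiffFun dom) : (op₁ γ).adjApp ψ = -(op₁ γ).app ψ := by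
  rw [app_op₁]
  funext i
  fin_cases i <;>
  · simp [adjApp_eq, adjMonomial, op₁, app₁, opEval_firstOrder, Dx_eq, totalDer_jetCoord, derivation_ofNat]
    ring

theorem adjApp_op₂ (ψ : Fin 2 → DiffFun dom) : op₂.adjApp ψ = -op₂.app ψ := by
  rw [app_op₂]
  funext i
  fin_cases i <;>
  · simp [adjApp_eq, adjMonomial, op₂, app₂, opEval_firstOrder, Dx_eq, totalDer_jetCoord, derivation_ofNat]
    ring

theorem adjApp_op₃ (γ : ℝ) (ψ : Fin 2 → DiffFun dom) : (op₃ γ).adjApp ψ = -(op₃ γ).app ψ := by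
  rw [app_op₃]
  funext i
  fin_cases i <;>
  · simp [adjApp_eq, adjMonomial, op₃, app₃, opEval_firstOrder, Dx_eq, totalDer_jetCoord, derivation_ofNat]
    ring

theorem evol_wFun (γ : ℝ) (φ : Fin 2 → DiffFun dom) :
    evol φ (wFun γ) = varW (jetCoord dom 1 0) invU1 (wFun γ) φ := by
  rw [derivation_wFun, evol_jetCoord, evol_jetCoord]
  rfl

/-- Needed because D_x w is itself a coefficient: its variation has to be D_x of the variation of w.
-/
theorem evol_totalDer_wFun (γ : ℝ) (φ : Fin 2 → DiffFun dom) :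
    evol φ (totalDer dom (wFun γ)) =
      totalDer dom (varW (jetCoord dom 1 0) invU1 (wFun γ) φ) := by
  simp only [totalDer_wFun, varW, Derivation.leibniz, map_sub, derivation_ofNat, evol_jetCoord,
    evol_invU1, evol_wFun, totalDer_jetCoord, totalDer_invU1, smul_eq_mul, Function.iterate_succ,
    Function.iterate_zero, Function.comp_apply, id, Dx_eq]
  ring

/-- The operator depends linearly on u, v, w, so varying it amounts to replacing these by φ 0, φ 1
and the variation of w. -/
theorem lin_op₁ (γ : ℝ) (ψ φ : Fin 2 → DiffFun dom) : (op₁ γ).lin ψ φ =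
    app₁ (totalDer dom) (φ 0) (φ 1) (varW (jetCoord dom 1 0) invU1 (wFun γ) φ) ψ := by
  funext i
  fin_cases i <;>
  · simp [lin_eq, op₁, app₁, opEval_firstOrder, Dx_eq, evol_jetCoord, evol_wFun, evol_totalDer_wFun,
      derivation_ofNat]
    ring

theorem lin_op₂ (ψ φ : Fin 2 → DiffFun dom) : op₂.lin ψ φ =
    app₂ (totalDer dom) (φ 0) (φ 1) ψ := by
  funext i
  fin_cases i <;>
  · simp [lin_eq, op₂, app₂, opEval_firstOrder, Dx_eq, evol_jetCoord, derivation_ofNat]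
    try ring

theorem lin_op₃ (γ : ℝ) (ψ φ : Fin 2 → DiffFun dom) : (op₃ γ).lin ψ φ =
    app₃ (totalDer dom) (φ 1) (varW (jetCoord dom 1 0) invU1 (wFun γ) φ) ψ := by
  funext i
  fin_cases i <;>
  · simp [lin_eq, op₃, app₃, opEval_firstOrder, Dx_eq, evol_jetCoord, evol_wFun, evol_totalDer_wFun,
      derivation_ofNat]
    try ring

end TwoComponents

/-! ### Composition of operators and the third-order operator -/

section ThirdOrder

theorem opComp_add_left {n : ℕ} {Ω : TopologicalSpace.Opens (Fin n → ℝ)} (a a' b : DiffOp Ω) :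
    opComp (a + a') b = opComp a b + opComp a' b := by
  refine Finsupp.sum_add_index' (fun k => ?_) fun k c c' => ?_
  · simp
  · rw [← Finsupp.sum_add]
    refine Finsupp.sum_congr fun m _ => ?_
    simp only [mul_add, add_mul, Finsupp.single_add, Finset.sum_add_distrib]

theorem opComp_add_right {n : ℕ} {Ω : TopologicalSpace.Opens (Fin n → ℝ)} (a b b' : DiffOp Ω) :
    opComp a (b + b') = opComp a b + opComp a b' := by
  simp only [opComp]
  rw [← Finsupp.sum_add]
  refine Finsupp.sum_congr fun k _ => ?_
  refine Finsupp.sum_add_index' (fun m => ?_) fun m d d' => ?_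
  · simp [iterate_Dx_eq]
  · simp only [iterate_Dx_eq, map_add, mul_add, Finsupp.single_add, Finset.sum_add_distrib]

theorem opComp_single {n : ℕ} {Ω : TopologicalSpace.Opens (Fin n → ℝ)} (k m : ℕ)
    (c d : DiffFun Ω) :
    opComp (Finsupp.single k c) (Finsupp.single m d) = ∑ j ∈ Finset.range (k + 1),
      Finsupp.single (k - j + m) ((k.choose j : DiffFun Ω) * c * Dx^[j] d) := by
  rw [opComp, Finsupp.sum_single_index, Finsupp.sum_single_index]
  · simp [iterate_Dx_eq]
  · simp

theorem opD_comp_single {n : ℕ} {Ω : TopologicalSpace.Opens (Fin n → ℝ)} (m : ℕ)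
    (d : DiffFun Ω) : opComp (opD Ω) (Finsupp.single m d) =
      Finsupp.single (m + 1) d + Finsupp.single m (totalDer Ω d) := by
  rw [opD, opComp_single, Finset.sum_range_succ, Finset.sum_range_one, add_comm m 1]
  simp [Dx_eq]

theorem single_zero_comp_opD {n : ℕ} {Ω : TopologicalSpace.Opens (Fin n → ℝ)} (c : DiffFun Ω) :
    opComp (Finsupp.single 0 c) (opD Ω) = Finsupp.single 1 c := by
  rw [opD, opComp_single, Finset.sum_range_one]
  simp

theorem single_one_comp_opD {n : ℕ} {Ω : TopologicalSpace.Opens (Fin n → ℝ)} (c : DiffFun Ω) :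
    opComp (Finsupp.single 1 c) (opD Ω) = Finsupp.single 2 c := by
  rw [opD, opComp_single, Finset.sum_range_succ, Finset.sum_range_one]
  simp [Dx_eq]

theorem opComp_zero_left {n : ℕ} {Ω : TopologicalSpace.Opens (Fin n → ℝ)} (b : DiffOp Ω) :
    opComp 0 b = 0 :=
  Finsupp.sum_zero_index

theorem opComp_zero_right {n : ℕ} {Ω : TopologicalSpace.Opens (Fin n → ℝ)} (a : DiffOp Ω) :
    opComp a 0 = 0 := by
  simp [opComp]

/-- The function `u^2/(u^1)^2`. -/
def sFun : DiffFun dom := u2 * invU1 ^ 2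

/-- The entries of `R^{(2)}`. -/
theorem R2_eq : R2 =
    ![![0, Finsupp.single 3 invU1 + Finsupp.single 2 (totalDer dom invU1)
        + (Finsupp.single 2 (totalDer dom invU1)
          + Finsupp.single 1 (totalDer dom (totalDer dom invU1)))],
      ![Finsupp.single 3 invU1 + Finsupp.single 2 (totalDer dom invU1),
        Finsupp.single 3 sFun + Finsupp.single 2 (totalDer dom sFun)
        + (Finsupp.single 3 sFun + Finsupp.single 2 (totalDer dom sFun)
          + (Finsupp.single 2 (totalDer dom sFun)
            + Finsupp.single 1 (totalDer dom (totalDer dom sFun))))]] := by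
  funext i j
  fin_cases i <;> fin_cases j <;>
  simp only [R2, opMul, sFun, Fin.zero_eta, Fin.mk_one, Matrix.cons_val_zero,
    Matrix.cons_val_one, opD_comp_single, zero_add, single_zero_comp_opD, single_one_comp_opD,
    opComp_add_left, opComp_add_right, opComp_zero_left, opComp_zero_right, Nat.reduceAdd]

theorem app_R2 (ψ : Fin 2 → DiffFun dom) : R2.app ψ = appR (totalDer dom) invU1 sFun ψ := by
  funext i
  fin_cases i <;>
  · simp only [app_eq, R2_eq, appR, Fin.sum_univ_two, Fin.zero_eta, Fin.mk_one,
      Matrix.cons_val_zero, Matrix.cons_val_one, map_add, map_zero, opEval_single,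
      LinearMap.mulRight_apply, Function.iterate_succ, Function.iterate_zero,
      Function.comp_apply, id, Dx_eq, Derivation.leibniz, smul_eq_mul]
    ring

theorem adjApp_R2 (ψ : Fin 2 → DiffFun dom) : R2.adjApp ψ = -R2.app ψ := by
  rw [app_R2]
  funext i
  fin_cases i <;>
  · simp only [adjApp_eq, adjMonomial, R2_eq, appR, Fin.sum_univ_two, Fin.zero_eta, Fin.mk_one,
      Matrix.cons_val_zero, Matrix.cons_val_one, map_add, map_zero, opEval_single, Pi.neg_apply,
      LinearMap.coe_mk, AddHom.coe_mk, Function.iterate_succ, Function.iterate_zero,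
      Function.comp_apply, id, Dx_eq, Derivation.leibniz, smul_eq_mul]
    ring

/-! ### Commutation of evolutionary and total derivatives on the coefficients of the third-order
operator. -/

theorem totalDer_sFun : totalDer dom sFun =
    invU1 ^ 2 * jetCoord dom 1 1 - 2 * invU1 * sFun * jetCoord dom 0 1 := by
  simp only [sFun, u2, Derivation.leibniz, Derivation.leibniz_pow, totalDer_jetCoord,
    totalDer_invU1, smul_eq_mul, nsmul_eq_mul, Nat.cast_ofNat]
  ring

theorem evol_sFun (φ : Fin 2 → DiffFun dom) :
    evol φ sFun = varS (jetCoord dom 1 0) invU1 φ := by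
  simp only [sFun, u2, Derivation.leibniz, Derivation.leibniz_pow, evol_jetCoord, evol_invU1,
    varS, smul_eq_mul, nsmul_eq_mul, Nat.cast_ofNat, Function.iterate_zero, id]
  ring

theorem evol_totalDer_jetCoord (φ : Fin 2 → DiffFun dom) (j : Fin 2) (l : ℕ) :
    evol φ (totalDer dom (jetCoord dom j l)) = totalDer dom (evol φ (jetCoord dom j l)) := by
  rw [totalDer_jetCoord, evol_jetCoord, evol_jetCoord, Function.iterate_succ_apply', Dx_eq]

/-- Evolutionary derivations commute with the total derivative on products of functions on which
they commute with it. -/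
theorem evol_totalDer_mul {φ : Fin 2 → DiffFun dom} {f g : DiffFun dom}
    (hf : evol φ (totalDer dom f) = totalDer dom (evol φ f))
    (hg : evol φ (totalDer dom g) = totalDer dom (evol φ g)) :
    evol φ (totalDer dom (f * g)) = totalDer dom (evol φ (f * g)) := by
  simp only [Derivation.leibniz, map_add, smul_eq_mul, hf, hg]
  ring

theorem evol_totalDer_invU1 (φ : Fin 2 → DiffFun dom) :
    evol φ (totalDer dom invU1) = totalDer dom (evol φ invU1) := by
  simp only [totalDer_invU1, evol_invU1, Derivation.leibniz, Derivation.leibniz_pow, map_neg,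
    evol_jetCoord, Function.iterate_succ, Function.iterate_zero, Function.comp_apply, id, Dx_eq,
    smul_eq_mul, nsmul_eq_mul]
  ring

theorem evol_totalDer_totalDer_invU1 (φ : Fin 2 → DiffFun dom) :
    evol φ (totalDer dom (totalDer dom invU1)) =
      totalDer dom (totalDer dom (evol φ invU1)) := by
  have h := evol_totalDer_invU1 φ
  -- Commutation is now needed on D_x r. It passes to products and real multiples, so D_x r is
  -- written as a multiple of a product of functions on which it is known.
  have e : totalDer dom invU1 = (-1 : ℝ) • (invU1 * (invU1 * jetCoord dom 0 1)) := by
    rw [totalDer_invU1, neg_smul, one_smul]; ring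
  rw [← h, e, Derivation.map_smul, Derivation.map_smul, Derivation.map_smul, Derivation.map_smul,
    evol_totalDer_mul h (evol_totalDer_mul h (evol_totalDer_jetCoord φ 0 1))]

theorem evol_totalDer_sFun (φ : Fin 2 → DiffFun dom) :
    evol φ (totalDer dom sFun) = totalDer dom (evol φ sFun) := by
  have h := evol_totalDer_invU1 φ
  have e : sFun = jetCoord dom 1 0 * (invU1 * invU1) := by rw [sFun, u2, sq]
  rw [e, evol_totalDer_mul (evol_totalDer_jetCoord φ 1 0) (evol_totalDer_mul h h)]

theorem evol_totalDer_totalDer_sFun (φ : Fin 2 → DiffFun dom) :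
    evol φ (totalDer dom (totalDer dom sFun)) = totalDer dom (totalDer dom (evol φ sFun)) := by
  have h := evol_totalDer_invU1 φ
  have hj := evol_totalDer_jetCoord φ
  have e : totalDer dom sFun = invU1 * (invU1 * jetCoord dom 1 1)
      + (-2 : ℝ) • (invU1 * (sFun * jetCoord dom 0 1)) := by
    rw [totalDer_sFun, neg_smul, ofNat_smul_eq_nsmul, nsmul_eq_mul]
    push_cast
    ring
  rw [← evol_totalDer_sFun, e]
  simp only [map_add, Derivation.map_smul,
    evol_totalDer_mul h (evol_totalDer_mul h (hj 1 1)),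
    evol_totalDer_mul h (evol_totalDer_mul (evol_totalDer_sFun φ) (hj 0 1))]

theorem lin_R2 (ψ φ : Fin 2 → DiffFun dom) : R2.lin ψ φ =
    appR (totalDer dom) (varR invU1 φ) (varS (jetCoord dom 1 0) invU1 φ) ψ := by
  have hR : evol φ invU1 = varR invU1 φ := evol_invU1 φ
  funext i
  fin_cases i <;>
  · simp only [lin_eq, R2_eq, appR, Fin.sum_univ_two, Fin.zero_eta, Fin.mk_one,
      Matrix.cons_val_zero, Matrix.cons_val_one, map_add, map_zero, opEval_single,
      LinearMap.comp_apply, Derivation.coeFn_coe, LinearMap.mulRight_apply,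
      Function.iterate_succ, Function.iterate_zero, Function.comp_apply, id, Dx_eq,
      evol_totalDer_totalDer_invU1, evol_totalDer_invU1, evol_totalDer_totalDer_sFun,
      evol_totalDer_sFun, hR, evol_sFun, Derivation.leibniz, smul_eq_mul]
    ring

end ThirdOrder

/-! ### The Levi-Civita connections of the three metrics -/

section Metrics

theorem hasLineDerivAt_const_mul_coord (c : ℝ) (u e : Fin 2 → ℝ) (i : Fin 2) :
    HasLineDerivAt ℝ (fun v : Fin 2 → ℝ => c * v i) (c * e i) u e := by
  have h : HasDerivAt (fun t : ℝ => c * (u i + t * e i)) (c * e i) 0 := by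
    simpa using (((hasDerivAt_id (0 : ℝ)).mul_const (e i)).const_add (u i)).const_mul c
  exact h

theorem hasLineDerivAt_coord (u e : Fin 2 → ℝ) (i : Fin 2) :
    HasLineDerivAt ℝ (fun v : Fin 2 → ℝ => v i) (e i) u e := by
  simpa using hasLineDerivAt_const_mul_coord 1 u e i

theorem hasLineDerivAt_w (γ : ℝ) {u : Fin 2 → ℝ} (hu : u 0 ≠ 0) (e : Fin 2 → ℝ) :
    HasLineDerivAt ℝ (fun v : Fin 2 → ℝ => (v 1 ^ 2 + γ) / v 0)
      ((2 * u 1 * e 1 - (u 1 ^ 2 + γ) / u 0 * e 0) / u 0) u e := by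
  have h0 : HasDerivAt (fun t : ℝ => (u + t • e) 0) (e 0) 0 := hasLineDerivAt_coord u e 0
  have h1 : HasDerivAt (fun t : ℝ => (u + t • e) 1) (e 1) 0 := hasLineDerivAt_coord u e 1
  have h := ((h1.pow 2).add_const γ).div h0 (by simpa using hu)
  refine h.congr_deriv ?_
  simp only [zero_smul, add_zero, Pi.pow_apply]
  field_simp
  push_cast
  ring

theorem inv_symm_fin_two (a b c : ℝ) :
    (!![a, b; b, c] : Matrix (Fin 2) (Fin 2) ℝ)⁻¹ =
      !![c / (a * c - b ^ 2), -b / (a * c - b ^ 2); -b / (a * c - b ^ 2), a / (a * c - b ^ 2)] := by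
  rw [Matrix.inv_def, Matrix.adjugate_fin_two_of, Matrix.det_fin_two_of, Ring.inverse_eq_inv',
    show a * c - b * b = a * c - b ^ 2 by ring]
  ext i j
  fin_cases i <;> fin_cases j <;> simp [div_eq_inv_mul]

/-- The partial derivatives of the inverse of a symmetric matrix. -/
theorem partialU_inv {g : (Fin 2 → ℝ) → Matrix (Fin 2) (Fin 2) ℝ} {a b c : (Fin 2 → ℝ) → ℝ}
    {a' b' c' : ℝ} {u : Fin 2 → ℝ} {k : Fin 2} (hg : ∀ v, g v = !![a v, b v; b v, c v])
    (ha : HasLineDerivAt ℝ a a' u (Pi.single k 1)) (hb : HasLineDerivAt ℝ b b' u (Pi.single k 1))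
    (hc : HasLineDerivAt ℝ c c' u (Pi.single k 1)) (hd : a u * c u - b u ^ 2 ≠ 0) (i j : Fin 2) :
    partialU k (fun v => (g v)⁻¹ i j) u =
      (!![c' / (a u * c u - b u ^ 2), -b' / (a u * c u - b u ^ 2);
          -b' / (a u * c u - b u ^ 2), a' / (a u * c u - b u ^ 2)]
        - ((a' * c u + a u * c' - 2 * b u * b') / (a u * c u - b u ^ 2)) • (g u)⁻¹) i j := by
  set e : Fin 2 → ℝ := Pi.single k 1
  have e0 : u + (0 : ℝ) • e = u := by simp
  have ha' : HasDerivAt (fun t : ℝ => a (u + t • e)) a' 0 := ha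
  have hb' : HasDerivAt (fun t : ℝ => b (u + t • e)) b' 0 := hb
  have hc' : HasDerivAt (fun t : ℝ => c (u + t • e)) c' 0 := hc
  have hdet := (ha'.mul hc').sub (hb'.pow 2)
  have hd0 : a (u + (0 : ℝ) • e) * c (u + (0 : ℝ) • e) - b (u + (0 : ℝ) • e) ^ 2 ≠ 0 := by
    rwa [e0]
  -- The inverse is the adjugate over the determinant, and the quotient rule gives adj′/det −
  -- (det′/det) g⁻¹.
  have key : ∀ i j, HasDerivAt (fun t : ℝ =>
      (!![c (u + t • e) / (a (u + t • e) * c (u + t • e) - b (u + t • e) ^ 2),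
        -b (u + t • e) / (a (u + t • e) * c (u + t • e) - b (u + t • e) ^ 2);
        -b (u + t • e) / (a (u + t • e) * c (u + t • e) - b (u + t • e) ^ 2),
        a (u + t • e) / (a (u + t • e) * c (u + t • e) - b (u + t • e) ^ 2)] :
        Matrix (Fin 2) (Fin 2) ℝ) i j)
      ((!![c' / (a u * c u - b u ^ 2), -b' / (a u * c u - b u ^ 2);
          -b' / (a u * c u - b u ^ 2), a' / (a u * c u - b u ^ 2)]
        - ((a' * c u + a u * c' - 2 * b u * b') / (a u * c u - b u ^ 2)) • (g u)⁻¹) i j) 0 := by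
    intro i j
    rw [hg, inv_symm_fin_two]
    fin_cases i <;> fin_cases j
    · refine (hc'.div hdet hd0).congr_deriv ?_
      simp
      field_simp
    · refine (hb'.neg.div hdet hd0).congr_deriv ?_
      simp
      field_simp
      ring
    · refine (hb'.neg.div hdet hd0).congr_deriv ?_
      simp
      field_simp
      ring
    · refine (ha'.div hdet hd0).congr_deriv ?_
      simp
      field_simp
  rw [← (key i j).deriv]
  simp only [partialU, lineDeriv, hg, inv_symm_fin_two]
  rfl

/-- The coefficients `Γ^{ij}_k` of `P^{(2,1)}`. -/
def gamma₁ (γ : ℝ) (i j k : Fin 2) (u : Fin 2 → ℝ) : ℝ :=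
  ![![![-1 / 2, 0], ![0, 1 / 2]],
    ![![0, -1 / 2], ![-((u 1 ^ 2 + γ) / u 0 / (2 * u 0)), u 1 / u 0]]] i j k

/-- The coefficients `Γ^{ij}_k` of `P^{(2,2)}`. -/
def gamma₂ (i j k : Fin 2) (_ : Fin 2 → ℝ) : ℝ :=
  ![![![0, 0], ![1, 0]], ![![0, 0], ![0, 1]]] i j k

/-- The coefficients `Γ^{ij}_k` of `P^{(2,3)}`. -/
def gamma₃ (γ : ℝ) (i j k : Fin 2) (u : Fin 2 → ℝ) : ℝ :=
  ![![![0, 1], ![0, 0]],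
    ![![-((u 1 ^ 2 + γ) / u 0 / u 0), 2 * u 1 / u 0], ![0, 0]]] i j k

theorem gamma₁_eq (γ : ℝ) {u : Fin 2 → ℝ} (hu : u 0 ≠ 0) (hd : (g1 γ u).det ≠ 0)
    (i j k : Fin 2) :
    gamma₁ γ i j k u = -∑ s : Fin 2, g1 γ u i s * christoffel (g1 γ) j s k u := by
  have hd' : -1 * u 0 * ((u 1 ^ 2 + γ) / u 0) - 0 ^ 2 ≠ 0 := by
    rwa [g1, Matrix.det_fin_two_of, ← sq, ← neg_one_mul (u 0)] at hd
  have hp := fun k => partialU_inv (g := g1 γ) (a := fun v => -1 * v 0) (b := fun _ => 0)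
    (c := fun v => (v 1 ^ 2 + γ) / v 0) (fun v => by rw [g1, neg_one_mul])
    (hasLineDerivAt_const_mul_coord (-1) u (Pi.single k 1) 0) (hasDerivAt_const _ _)
    (hasLineDerivAt_w γ hu (Pi.single k 1)) hd'
  simp only [christoffel, hp]
  simp only [g1, inv_symm_fin_two, Fin.sum_univ_two, gamma₁]
  -- Once the derivatives are computed, γ occurs only through w, which becomes a free variable;
  -- nondegeneracy of the metric makes it nonzero.
  generalize (u 1 ^ 2 + γ) / u 0 = w at hd' ⊢
  have hw : w ≠ 0 := by rintro rfl; simp at hd'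
  fin_cases i <;> fin_cases j <;> fin_cases k <;> simp [hu, hw] <;> field_simp <;> ring

/-- The determinant is −u², so this metric is nondegenerate on the whole domain. -/
theorem gamma₂_eq {u : Fin 2 → ℝ} (hu : u 0 ≠ 0) (i j k : Fin 2) :
    gamma₂ i j k u = -∑ s : Fin 2, g2 u i s * christoffel g2 j s k u := by
  have hd' : 0 * (2 * u 1) - u 0 ^ 2 ≠ 0 := by simpa using hu
  have hp := fun k => partialU_inv (g := g2) (a := fun _ => 0) (b := fun v => v 0)
    (c := fun v => 2 * v 1) (fun _ => rfl) (hasDerivAt_const _ _)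
    (hasLineDerivAt_coord u (Pi.single k 1) 0)
    (hasLineDerivAt_const_mul_coord 2 u (Pi.single k 1) 1) hd'
  simp only [christoffel, hp]
  simp only [g2, inv_symm_fin_two, Fin.sum_univ_two, gamma₂]
  fin_cases i <;> fin_cases j <;> fin_cases k <;> simp [hu] <;> field_simp <;> ring

theorem gamma₃_eq (γ : ℝ) {u : Fin 2 → ℝ} (hu : u 0 ≠ 0) (hd : (g3 γ u).det ≠ 0)
    (i j k : Fin 2) :
    gamma₃ γ i j k u = -∑ s : Fin 2, g3 γ u i s * christoffel (g3 γ) j s k u := by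
  have hd' : 2 * u 1 * 0 - ((u 1 ^ 2 + γ) / u 0) ^ 2 ≠ 0 := by
    rwa [g3, Matrix.det_fin_two_of, ← sq] at hd
  have hp := fun k => partialU_inv (g := g3 γ) (a := fun v => 2 * v 1)
    (b := fun v => (v 1 ^ 2 + γ) / v 0) (c := fun _ => 0) (fun _ => rfl)
    (hasLineDerivAt_const_mul_coord 2 u (Pi.single k 1) 1)
    (hasLineDerivAt_w γ hu (Pi.single k 1)) (hasDerivAt_const _ _) hd'
  simp only [christoffel, hp]
  simp only [g3, inv_symm_fin_two, Fin.sum_univ_two, gamma₃]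
  generalize (u 1 ^ 2 + γ) / u 0 = w at hd' ⊢
  have hw : w ≠ 0 := by rintro rfl; simp at hd'
  fin_cases i <;> fin_cases j <;> fin_cases k <;> simp [hw] <;> field_simp <;> ring

end Metrics

/-! ### Hamiltonian and compatible operators -/

section Compatibility

/-- `FA` and `BA` express the operator `A` and, up to total derivatives, its linearization through
the jet coordinates. -/
def IsModelled (γ : ℝ) (A : MatDiffOp dom)
    (FA : JetData (DiffFun dom) → (Fin 2 → DiffFun dom) → Fin 2 → DiffFun dom)
    (BA : JetData (DiffFun dom) →
      (Fin 2 → DiffFun dom) → (Fin 2 → DiffFun dom) → (Fin 2 → DiffFun dom) → DiffFun dom) : Prop :=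
  ∀ Ψ, A.app = FA (jetData γ Ψ) ∧ ∃ CA : (Fin 2 → DiffFun dom) → (Fin 2 → DiffFun dom) →
    (Fin 2 → DiffFun dom) → DiffFun dom, ∀ ψ φ θ,
      pair (A.lin ψ φ) θ = BA (jetData γ Ψ) ψ φ θ + totalDer dom (CA ψ φ θ)

/-- The abstract identity is applied to the jet data built from the three given covectors; the
divergences dropped from the linearizations are then restored by `bracket_eq`. -/
theorem IsModelled.schoutenVanishes {γ : ℝ} {A B : MatDiffOp dom} {FA FB BA BB}
    (hA : IsModelled γ A FA BA) (hB : IsModelled γ B FB BB)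
    (h : ∀ J, ∃ χ, bracket (BA J) (BB J) (FA J) (FB J) J.covector = J.D χ) :
    SchoutenVanishes A B := by
  intro ψ₁ ψ₂ ψ₃
  obtain ⟨hFA, CA, hCA⟩ := hA ![ψ₁, ψ₂, ψ₃]
  obtain ⟨hFB, CB, hCB⟩ := hB ![ψ₁, ψ₂, ψ₃]
  have h' := h (jetData γ ![ψ₁, ψ₂, ψ₃])
  rw [covector_jetData, ← hFA, ← hFB] at h'
  obtain ⟨χ, hχ⟩ := bracket_eq hCA hCB h'
  exact ⟨χ, by rw [Dx_eq, ← hχ]; rfl⟩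

theorem isModelled_op₁ (γ : ℝ) : IsModelled γ (op₁ γ) JetData.F₁ JetData.B₁ := fun Ψ =>
  ⟨funext (app_op₁ γ), _, fun ψ φ θ => by
    rw [lin_op₁]; exact (jetData γ Ψ).pairing_L₁ ψ φ θ⟩

theorem isModelled_op₂ (γ : ℝ) : IsModelled γ op₂ JetData.F₂ JetData.B₂ := fun Ψ =>
  ⟨funext app_op₂, _, fun ψ φ θ => by
    rw [lin_op₂]; exact (jetData γ Ψ).pairing_L₂ ψ φ θ⟩

theorem isModelled_op₃ (γ : ℝ) : IsModelled γ (op₃ γ) JetData.F₃ JetData.B₃ := fun Ψ =>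
  ⟨funext (app_op₃ γ), _, fun ψ φ θ => by
    rw [lin_op₃]; exact (jetData γ Ψ).pairing_L₃ ψ φ θ⟩

theorem isModelled_R2 (γ : ℝ) : IsModelled γ R2 JetData.FR JetData.BR := fun Ψ =>
  ⟨funext app_R2, _, fun ψ φ θ => by
    rw [lin_R2]; exact (jetData γ Ψ).pairing_LR ψ φ θ⟩

theorem isHamiltonian_op₁ (γ : ℝ) : IsHamiltonian (op₁ γ) :=
  ⟨adjApp_op₁ γ, (isModelled_op₁ γ).schoutenVanishes (isModelled_op₁ γ) JetData.bracket₁₁⟩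

theorem isHamiltonian_op₂ : IsHamiltonian op₂ :=
  -- The operator does not involve γ, so any value serves for the jet data.
  ⟨adjApp_op₂, (isModelled_op₂ 0).schoutenVanishes (isModelled_op₂ 0) JetData.bracket₂₂⟩

theorem isHamiltonian_op₃ (γ : ℝ) : IsHamiltonian (op₃ γ) :=
  ⟨adjApp_op₃ γ, (isModelled_op₃ γ).schoutenVanishes (isModelled_op₃ γ) JetData.bracket₃₃⟩

theorem isHamiltonian_R2 : IsHamiltonian R2 :=
  ⟨adjApp_R2, (isModelled_R2 0).schoutenVanishes (isModelled_R2 0) JetData.bracketRR⟩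

end Compatibility

/-! ### The first-order operators -/

section FirstOrder

theorem coe_wFun (γ : ℝ) (p : JetOver dom) :
    (wFun γ).1 p = (p.1.2 0 1 ^ 2 + γ) / p.1.2 0 0 := (div_eq_mul_inv _ _).symm

theorem coe_Dx_wFun (γ : ℝ) (p : JetOver dom) : (Dx (wFun γ)).1 p =
    -((p.1.2 0 1 ^ 2 + γ) / p.1.2 0 0 / p.1.2 0 0) * p.1.2 1 0
      + 2 * p.1.2 0 1 / p.1.2 0 0 * p.1.2 1 1 := by
  rw [Dx_eq, totalDer_wFun]
  change 2 * (p.1.2 0 0)⁻¹ * p.1.2 0 1 * p.1.2 1 1 - (p.1.2 0 0)⁻¹ * (wFun γ).1 p * p.1.2 1 0 = _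
  rw [coe_wFun]
  ring

theorem firstOrder_one (a b : DiffFun dom) : firstOrder a b 1 = a := by simp [firstOrder]

theorem firstOrder_zero (a b : DiffFun dom) : firstOrder a b 0 = b := by simp [firstOrder]

theorem firstOrder_of_two_le (a b : DiffFun dom) {m : ℕ} (hm : 2 ≤ m) : firstOrder a b m = 0 := by
  have h0 : 0 ≠ m := by omega
  have h1 : 1 ≠ m := by omega
  simp [firstOrder, h0, h1]

theorem contDiffOn_w (γ : ℝ) :
    ContDiffOn ℝ ∞ (fun u : Fin 2 → ℝ => (u 1 ^ 2 + γ) / u 0) dom :=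
  ContDiffOn.div (ContDiff.contDiffOn (by fun_prop)) (ContDiff.contDiffOn (by fun_prop))
    fun _ hu => hu

theorem contDiffOn_div_coord {f : (Fin 2 → ℝ) → ℝ} (hf : ContDiffOn ℝ ∞ f dom) :
    ContDiffOn ℝ ∞ (fun u => f u / u 0) dom :=
  hf.div (ContDiff.contDiffOn (by fun_prop)) fun _ hu => hu

theorem isDubrovinNovikov_op₁ (γ : ℝ) : IsDubrovinNovikov ((1 / 2 : ℝ) • op₁ γ) (g1 γ) := by
  refine ⟨gamma₁ γ, fun i j k => ?_, fun u hu hd => gamma₁_eq γ hu hd, fun i j => ⟨?_, ?_, ?_⟩⟩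
  · have h1 : ContDiffOn ℝ ∞ (fun u : Fin 2 → ℝ => u 1 / u 0) dom :=
      contDiffOn_div_coord (ContDiff.contDiffOn (by fun_prop))
    have h2 : ContDiffOn ℝ ∞
        (fun u : Fin 2 → ℝ => -((u 1 ^ 2 + γ) / u 0 / (2 * u 0))) dom := by
      refine ((contDiffOn_w γ).div (ContDiff.contDiffOn (by fun_prop)) fun u hu => ?_).neg
      exact mul_ne_zero two_ne_zero hu
    fin_cases i <;> fin_cases j <;> fin_cases k <;>
      first
        | exact h1
        | exact h2
        | exact contDiffOn_const
  · intro p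
    change 1 / 2 * (op₁ γ i j 1).1 p = _
    have h2 : (2 * wFun γ).1 p = 2 * ((p.1.2 0 1 ^ 2 + γ) / p.1.2 0 0) :=
      congrArg (2 * ·) (coe_wFun γ p)
    have h0 : (-2 * jetCoord dom 0 0).1 p = -2 * p.1.2 0 0 := rfl
    fin_cases i <;> fin_cases j <;> simp [op₁, firstOrder_one, g1, h0, h2]
  · intro p
    change 1 / 2 * (op₁ γ i j 0).1 p = _
    have h0 : (-jetCoord dom 0 1).1 p = -p.1.2 1 0 := rfl
    have h1 : (jetCoord dom 1 1).1 p = p.1.2 1 1 := rfl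
    have h2 : (-jetCoord dom 1 1).1 p = -p.1.2 1 1 := rfl
    fin_cases i <;> fin_cases j <;>
    simp [op₁, firstOrder_zero, gamma₁, coe_Dx_wFun, h0, h1, h2] <;> ring
  · intro m hm
    change (1 / 2 : ℝ) • (op₁ γ i j m) = _
    fin_cases i <;> fin_cases j <;> simp [op₁, firstOrder_of_two_le _ _ hm]

theorem isDubrovinNovikov_op₂ : IsDubrovinNovikov op₂ g2 := by
  refine ⟨gamma₂, fun _ _ _ => contDiffOn_const, fun u hu _ => gamma₂_eq hu,
    fun i j => ⟨?_, ?_, ?_⟩⟩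
  · intro p
    have h0 : (jetCoord dom 0 0).1 p = p.1.2 0 0 := rfl
    have h1 : (2 * jetCoord dom 1 0).1 p = 2 * p.1.2 0 1 := rfl
    fin_cases i <;> fin_cases j <;> simp [op₂, firstOrder_one, g2, h0, h1]
  · intro p
    have h0 : (jetCoord dom 0 1).1 p = p.1.2 1 0 := rfl
    have h1 : (jetCoord dom 1 1).1 p = p.1.2 1 1 := rfl
    fin_cases i <;> fin_cases j <;> simp [op₂, firstOrder_zero, gamma₂, h0, h1]
  · intro m hm
    fin_cases i <;> fin_cases j <;> simp [op₂, firstOrder_of_two_le _ _ hm]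

theorem isDubrovinNovikov_op₃ (γ : ℝ) : IsDubrovinNovikov (op₃ γ) (g3 γ) := by
  refine ⟨gamma₃ γ, fun i j k => ?_, fun u hu hd => gamma₃_eq γ hu hd, fun i j => ⟨?_, ?_, ?_⟩⟩
  · have h1 : ContDiffOn ℝ ∞ (fun u : Fin 2 → ℝ => 2 * u 1 / u 0) dom :=
      contDiffOn_div_coord (ContDiff.contDiffOn (by fun_prop))
    have h2 : ContDiffOn ℝ ∞ (fun u : Fin 2 → ℝ => -((u 1 ^ 2 + γ) / u 0 / u 0)) dom :=
      (contDiffOn_div_coord (contDiffOn_w γ)).neg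
    fin_cases i <;> fin_cases j <;> fin_cases k <;>
      first
        | exact h1
        | exact h2
        | exact contDiffOn_const
  · intro p
    have h0 : (2 * jetCoord dom 1 0).1 p = 2 * p.1.2 0 1 := rfl
    fin_cases i <;> fin_cases j <;> simp [op₃, firstOrder_one, g3, h0, coe_wFun]
  · intro p
    have h0 : (jetCoord dom 1 1).1 p = p.1.2 1 1 := rfl
    fin_cases i <;> fin_cases j <;> simp [op₃, firstOrder_zero, gamma₃, h0, coe_Dx_wFun]
  · intro m hm
    fin_cases i <;> fin_cases j <;> simp [op₃, firstOrder_of_two_le _ _ hm]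

/-- The variational derivative of a functional whose density is a function of the field variables,
given as a differential function. -/
theorem varDeriv_ofBase_eq {h : (Fin 2 → ℝ) → ℝ} (hh : ContDiffOn ℝ ∞ h dom) {H : DiffFun dom}
    (hH : ∀ p : JetOver dom, h (p.1.2 0) = H.1 p) (i : Fin 2) :
    varDeriv (ofBase h hh) i = dirDer (0, Pi.single 0 (Pi.single i 1)) H := by
  rw [varDeriv_ofBase, dirDer_eq_pd]
  congr 1
  exact Subtype.ext (funext hH)

/-! ### Hamiltonian densities of the system. -/

theorem dirDer_zero_jetCoord (i j : Fin 2) :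
    dirDer (0, Pi.single 0 (Pi.single i 1)) (jetCoord dom j 0) = if i = j then 1 else 0 := by
  rw [dirDer_eq_pd, pd_jetCoord]
  simp

theorem systemRHS_eq (γ : ℝ) : systemRHS γ = ![jetCoord dom 1 1, totalDer dom (wFun γ)] := by
  rw [systemRHS, u2, Dx_jetCoord, Dx_eq]
  rfl

theorem isHamiltonianSystem_op₁ (γ : ℝ) :
    IsHamiltonianSystem ((1 / 2 : ℝ) • op₁ γ) (systemRHS γ) := by
  -- The gradient of 2v is constant, so only the zeroth-order coefficients act; the second column of
  -- `op₁` supplies v_x and w_x.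
  have hh : ContDiffOn ℝ ∞ (fun u : Fin 2 → ℝ => 2 * u 1) dom :=
    ContDiff.contDiffOn (by fun_prop)
  refine ⟨_, hh, ?_⟩
  have hv : varDeriv (ofBase _ hh) = ![0, 2] := by
    funext i
    rw [varDeriv_ofBase_eq hh (H := 2 * jetCoord dom 1 0) fun _ => rfl]
    fin_cases i <;> simp [dirDer_zero_jetCoord, derivation_ofNat]
  rw [hv, app_smul, app_op₁, systemRHS_eq]
  funext i
  have h : app₁ (totalDer dom) (jetCoord dom 0 0) (jetCoord dom 1 0) (wFun γ) ![0, 2] i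
      = (2 : ℝ) • (![jetCoord dom 1 1, totalDer dom (wFun γ)] : Fin 2 → DiffFun dom) i := by
    rw [ofNat_smul_eq_nsmul, nsmul_eq_mul]
    fin_cases i <;> simp [app₁, totalDer_jetCoord, derivation_ofNat, mul_comm]
  rw [Pi.smul_apply, h, smul_smul]
  norm_num

theorem isHamiltonianSystem_op₃ (γ : ℝ) : IsHamiltonianSystem (op₃ γ) (systemRHS γ) := by
  -- Again the gradient is constant, and the first column of zeroth-order coefficients is already
  -- (v_x, w_x).
  have hh : ContDiffOn ℝ ∞ (fun u : Fin 2 → ℝ => u 0) dom :=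
    ContDiff.contDiffOn (by fun_prop)
  refine ⟨_, hh, ?_⟩
  have hv : varDeriv (ofBase _ hh) = ![1, 0] := by
    funext i
    rw [varDeriv_ofBase_eq hh (H := jetCoord dom 0 0) fun _ => rfl]
    fin_cases i <;> simp [dirDer_zero_jetCoord]
  rw [hv, app_op₃, systemRHS_eq]
  funext i
  fin_cases i <;> simp [app₃, totalDer_jetCoord]

theorem isHamiltonianSystem_op₂ (γ : ℝ) : IsHamiltonianSystem op₂ (systemRHS γ) := by
  -- The first row of `op₂` is (0, D_x ∘ u), which suggests ∂h/∂v = v/u and so h = v²/(2u) + f(u).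
  -- The second row then requires f″ = −γ/u³, solved by f = −γ/(2u).
  have hh : ContDiffOn ℝ ∞ (fun u : Fin 2 → ℝ => 1 / 2 * ((u 1 ^ 2 - γ) / u 0)) dom :=
    contDiffOn_const.mul (contDiffOn_div_coord (ContDiff.contDiffOn (by fun_prop)))
  refine ⟨_, hh, ?_⟩
  -- The constants 1/2 and γ become ring elements c and g, known only through 2c = 1 and the
  -- vanishing of their derivatives, so that the identities are polynomial.
  set c : DiffFun dom := algebraMap ℝ (DiffFun dom) (1 / 2) with hc
  set g : DiffFun dom := algebraMap ℝ (DiffFun dom) γ with hg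
  have two_c : 2 * c = 1 := by
    rw [hc, ← map_ofNat (algebraMap ℝ (DiffFun dom)) 2, ← map_mul]
    norm_num
  have D_c : ∀ D : Derivation ℝ (DiffFun dom) (DiffFun dom), D c = 0 := fun D =>
    D.map_algebraMap _
  have D_g : ∀ D : Derivation ℝ (DiffFun dom) (DiffFun dom), D g = 0 := fun D =>
    D.map_algebraMap _
  have hv : varDeriv (ofBase _ hh) =
      ![-(c * (jetCoord dom 1 0 ^ 2 - g) * invU1 ^ 2), jetCoord dom 1 0 * invU1] := by
    funext i
    rw [varDeriv_ofBase_eq hh (H := c * ((jetCoord dom 1 0 ^ 2 - g) * invU1)) fun p => by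
      rw [div_eq_mul_inv]; rfl]
    simp only [Derivation.leibniz, Derivation.leibniz_pow, map_sub, D_c, D_g, derivation_invU1,
      dirDer_zero_jetCoord, smul_eq_mul, nsmul_eq_mul, Nat.cast_ofNat]
    fin_cases i
    · simp
      ring
    · simp
      linear_combination (jetCoord dom 1 0 * invU1) * two_c
  rw [hv, app_op₂, systemRHS_eq]
  funext i
  fin_cases i
  · simp only [app₂, Fin.zero_eta, Matrix.cons_val_zero, Matrix.cons_val_one, Derivation.leibniz,
      totalDer_jetCoord, totalDer_invU1, smul_eq_mul]
    linear_combination (-(jetCoord dom 1 1 - jetCoord dom 1 0 * invU1 * jetCoord dom 0 1)) *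
      invU1_mul
  · have hw : totalDer dom (wFun γ) = 2 * invU1 * jetCoord dom 1 0 * jetCoord dom 1 1
        - invU1 * ((jetCoord dom 1 0 ^ 2 + g) * invU1) * jetCoord dom 0 1 := totalDer_wFun γ
    simp only [app₂, Fin.mk_one, Matrix.cons_val_zero, Matrix.cons_val_one, Derivation.leibniz,
      Derivation.leibniz_pow, map_neg, map_sub, D_c, D_g, totalDer_jetCoord, totalDer_invU1,
      hw, smul_eq_mul, nsmul_eq_mul, Nat.cast_ofNat]
    linear_combination
      (-(2 * c * ((jetCoord dom 1 0 ^ 2 - g) * invU1 ^ 2 * jetCoord dom 0 1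
        - invU1 * jetCoord dom 1 0 * jetCoord dom 1 1))) * invU1_mul
      - ((jetCoord dom 1 0 ^ 2 - g) * invU1 ^ 2 * jetCoord dom 0 1
        - invU1 * jetCoord dom 1 0 * jetCoord dom 1 1) * two_c

end FirstOrder

end HamOp

end

theorem mainTheorem5 (γ : ℝ) :
    ∃ P₁ P₂ P₃ : MatDiffOp dom,
      (IsDubrovinNovikov P₁ (g1 γ) ∧ IsDubrovinNovikov P₂ g2 ∧ IsDubrovinNovikov P₃ (g3 γ)) ∧
      (IsHamiltonian P₁ ∧ IsHamiltonian P₂ ∧ IsHamiltonian P₃) ∧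
      (IsHamiltonianSystem P₁ (systemRHS γ) ∧ IsHamiltonianSystem P₂ (systemRHS γ) ∧
        IsHamiltonianSystem P₃ (systemRHS γ)) ∧
      (Compatible P₁ P₂ ∧ Compatible P₁ P₃ ∧ Compatible P₂ P₃) ∧
      (Compatible P₁ R2 ∧ Compatible P₂ R2 ∧ Compatible P₃ R2) := by
  have m₁ := isModelled_op₁ γ
  have m₂ := isModelled_op₂ γ
  have m₃ := isModelled_op₃ γ
  have mR := isModelled_R2 γ
  have h₁ := (isHamiltonian_op₁ γ).smul (1 / 2)
  have h₂ := isHamiltonian_op₂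
  have h₃ := isHamiltonian_op₃ γ
  have hR := isHamiltonian_R2
  refine ⟨(1 / 2 : ℝ) • op₁ γ, op₂, op₃ γ,
    ⟨isDubrovinNovikov_op₁ γ, isDubrovinNovikov_op₂, isDubrovinNovikov_op₃ γ⟩, ⟨h₁, h₂, h₃⟩,
    ⟨isHamiltonianSystem_op₁ γ, isHamiltonianSystem_op₂ γ, isHamiltonianSystem_op₃ γ⟩,
    ⟨?_, ?_, ?_⟩, ⟨?_, ?_, ?_⟩⟩
  · exact h₁.compatible h₂ ((m₁.schoutenVanishes m₂ JetData.bracket₁₂).smul _)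
  · exact h₁.compatible h₃ ((m₁.schoutenVanishes m₃ JetData.bracket₁₃).smul _)
  · exact h₂.compatible h₃ (m₂.schoutenVanishes m₃ JetData.bracket₂₃)
  · exact h₁.compatible hR ((m₁.schoutenVanishes mR JetData.bracket₁R).smul _)
  · exact h₂.compatible hR (m₂.schoutenVanishes mR JetData.bracket₂R)
  · exact h₃.compatible hR (m₃.schoutenVanishes mR JetData.bracket₃R)
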